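/- For rational $T>0$ let $L^2_\star(0,T)$ be the space of all $u\in L^2(-\infty,T)$ with $u=0$ a.e. in $(-\infty,0)$, and for $S\subseteq\mathbb R$ let $L^2_\star(0,T;S)$ be the set of those $u\in L^2_\star(0,T)$ with $u\in S$ a.e. in $(0,T)$. For $u\in L^2_\star(0,T)$ put $Du(\varphi)=-\int_{-\infty}^T u\varphi'\,dt$ for $\varphi\in C_c^\infty(-\infty,T)$, write $Du\ge Dv$ if $Du(\varphi)\ge Dv(\varphi)$ for all $\varphi\ge 0$, and let $|u|_{BV}=\sup\{\int_{-\infty}^T u\varphi'\,dt:\varphi\in C_c^\infty(-\infty,T),\ \|\varphi\|_\infty\le 1\}$. For $\sigma\in\mathbb N$ let $$U(\sigma)=\{u\in L^2_\star(0,T;\{0,1\}): |u|_{BV}\le\sigma\},$$ $$U(\sigma)^{\rm ext}=\{(u,z): u\in L^2_\star(0,T;[0,1]),\ z\in L^2_\star(0,T;[0,\tfrac\sigma2]),\ Dz\ge Du,\ Dz\ge 0\}.$$ For $N\ge 1$ and $v\in\mathbb R^N$ let $\overline v\in L^2_\star(0,T)$ be the function equal to $v_i$ on $((i-1)\frac TN,i\frac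 TN)$, $i=1,\dots,N$; the index $N$ on a set of functions (or of tuples of functions) denotes its subset of all elements that are (componentwise) of the form $\overline v$, $v\in\mathbb R^N$. **Theorem.** Let $\sigma$ be even. Then $U(\sigma)^{\rm ext}$ is a small extended formulation of $U(\sigma)$ which is compatible with discretization. That is, for each input $(T,\sigma)$ with $T\in\mathbb Q$, $T>0$, and $\sigma\in\mathbb N$ even, there is a finite list of constraints, each of the form $L(u,z)\ge 0$ a.e. in $(0,T)$ or $DL(u,z)\ge 0$ with a continuous affine-linear operator $L\colon L^2_\star(0,T)^2\to L^2_\star(0,T)$, such that the following hold. 1. (Extended formulation) The projection of $U(\sigma)^{\rm ext}$ to the first coordinate $u$ is the closed convex hull $\overline{\rm conv}(U(\sigma))$ in $L^2_\star(0,T)$, and $U(\sigma)^{\rm ext}$ is exactly the set of all $(u,z)\in L^2_\star(0,T)^2$ that satisfy the listed constraints. 2. (Smallness) The number of controls (here two) and the number of listed constraints are bounded by a polynomial in the size of the binary encoding of $(T,\sigma)$. 3. (Compatibility with discretization) For all $N\ge1$: the projection of $(U(\sigma)^{\rm ext})_N$ to the first coordinate is ${\rm conv}(U(\sigma)_N)$;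 each operator $L$ in the list maps $(L^2_\star(0,T)^{2})_N$ to $L^2_\star(0,T)_N$; and the coefficients of these restrictions, viewed as affine-linear maps $\mathbb R^{2N}\to\mathbb R^N$, are rational and can be computed in polynomial time: there are polynomial-time Turing machines that compute each coefficient of the linear part and of the constant part from $T$, $\sigma$, $N$, the number of the constraint and the position of the coefficient, all given in binary. -/

import Mathlib

open MeasureTheory Set Computability
open scoped ENNReal Distributions

namespace Switching

noncomputable section

/-! ### Function spaces on `(-∞, T)` -/

/-- The space `L²(-∞, T)`. -/
abbrev L2 (T : ℝ) : Type := Lp ℝ 2 (volume.restrict (Iio T))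

/-- The space `L²⋆(0, T)` of all `u ∈ L²(-∞, T)` that vanish a.e. in `(-∞, 0)`,
with the norm of `L²(-∞, T)`. -/
def L2star (T : ℝ) : Submodule ℝ (L2 T) where
  carrier := {u | ∀ᵐ t ∂(volume.restrict (Iio T)), t < 0 → u t = 0}
  zero_mem' := by
    filter_upwards [Lp.coeFn_zero ℝ 2 (volume.restrict (Iio T))] with t ht _
    simpa using ht
  add_mem' := by
    intro u v hu hv
    filter_upwards [hu, hv, Lp.coeFn_add u v] with t h1 h2 h3 ht
    exact h3.trans (by simp [h1 ht, h2 ht])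
  smul_mem' := by
    intro c u hu
    filter_upwards [hu, Lp.coeFn_smul c u] with t h1 h2 ht
    exact h2.trans (by simp [h1 ht])

/-- A pointwise (a.e. defined) representative of `u ∈ L²⋆(0, T)`. -/
def rep {T : ℝ} (u : L2star T) : ℝ → ℝ := ((u : L2 T) : ℝ → ℝ)

/-- `L²⋆(0, T; S)`: the functions in `L²⋆(0, T)` with values in `S` a.e. in `(0, T)`. -/
def L2starIn (T : ℝ) (S : Set ℝ) : Set (L2star T) :=
  {u | ∀ᵐ t ∂(volume.restrict (Ioo 0 T)), rep u t ∈ S}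

/-- The open interval `(-∞, T)`. -/
def domain (T : ℝ) : TopologicalSpace.Opens ℝ := ⟨Iio T, isOpen_Iio⟩

/-- The distributional derivative `Du`, evaluated at the test function `φ ∈ C_c^∞(-∞, T)`. -/
def distribDeriv {T : ℝ} (u : L2star T) (φ : 𝓓(domain T, ℝ)) : ℝ :=
  -∫ t in Iio T, rep u t * deriv φ t

/-- `Du ≤ Dv`, tested against all non-negative test functions. -/
def DerivLE {T : ℝ} (u v : L2star T) : Prop :=
  ∀ φ : 𝓓(domain T, ℝ), (∀ t, 0 ≤ φ t) → distribDeriv u φ ≤ distribDeriv v φ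

/-- The seminorm `|u|_{BV(-∞,T)}`: the supremum of `∫ u φ'` over all test functions `φ` on
`(-∞, T)` with `‖φ‖_∞ ≤ 1`. (The value at `φ = 0` is zero, so nothing is lost by
truncating at zero.) -/
def variation {T : ℝ} (u : L2star T) : ℝ≥0∞ :=
  ⨆ (φ : 𝓓(domain T, ℝ)) (_ : ∀ t, |φ t| ≤ 1),
    ENNReal.ofReal (∫ t in Iio T, rep u t * deriv φ t)

/-- `BV⋆(0, T; S)`. -/
def BVstarIn (T : ℝ) (S : Set ℝ) : Set (L2star T) :=
  {u | u ∈ L2starIn T S ∧ variation u < ⊤}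

/-! ### Discretization -/

/-- `IsStep N v u` says `u = v̄`: the function `u ∈ L²⋆(0, T)` has the constant value `v i` on
the `i`-th of the `N` cells of the equidistant grid on `(0, T)` (cells are counted from `0`). -/
def IsStep {T : ℝ} (N : ℕ) (v : Fin N → ℝ) (u : L2star T) : Prop :=
  ∀ i : Fin N, ∀ᵐ t ∂(volume.restrict (Ioo ((i : ℝ) * (T / N)) (((i : ℝ) + 1) * (T / N)))),
    rep u t = v i

/-- Every vector `v` has a piecewise constant function `v̄`. -/
theorem exists_isStep {T : ℝ} (hT : 0 < T) {N : ℕ} (hN : 0 < N) (v : Fin N → ℝ) :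
    ∃ u : L2star T, IsStep N v u := by
  have hN' : (0:ℝ) < N := by exact_mod_cast hN
  have hTN : 0 < T / N := by positivity
  let f : ℝ → ℝ := fun t => ∑ i : Fin N, (Ioo ((i : ℝ) * (T / N)) (((i : ℝ) + 1) * (T / N))).indicator (fun _ => v i) t
  have hf : MemLp f 2 (volume.restrict (Iio T)) := by
    refine memLp_finsetSum _ fun i _ => ?_
    refine memLp_indicator_const 2 measurableSet_Ioo _ (Or.inr ?_)
    exact ((Measure.restrict_apply_le _ _).trans_lt (by simp)).ne
  have hu : hf.toLp f ∈ L2star T := by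
    show ∀ᵐ t ∂_, _
    filter_upwards [hf.coeFn_toLp] with t ht h0
    rw [ht]
    refine Finset.sum_eq_zero fun i _ => indicator_of_notMem (fun h => ?_) _
    have : 0 ≤ (i:ℝ) * (T/N) := by positivity
    linarith [h.1]
  refine ⟨⟨_, hu⟩, fun i => ?_⟩
  have hsub : Ioo ((i : ℝ) * (T / N)) (((i : ℝ) + 1) * (T / N)) ⊆ Iio T := fun t ht => by
    have h1 : ((i:ℕ):ℝ) + 1 ≤ N := by exact_mod_cast i.2
    have : ((i:ℝ)+1) * (T/N) ≤ N * (T/N) := by gcongr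
    have h2 : (N:ℝ) * (T/N) = T := by field_simp
    exact lt_of_lt_of_le ht.2 (by linarith)
  have := ae_mono (Measure.restrict_mono_set volume hsub) hf.coeFn_toLp
  filter_upwards [this, ae_restrict_mem measurableSet_Ioo] with t h1 h2
  show (hf.toLp f) t = _
  rw [h1]
  show ∑ j, _ = _
  rw [Finset.sum_eq_single i]
  · exact indicator_of_mem h2 _
  · intro j _ hji
    refine indicator_of_notMem (fun h => hji ?_) _
    have a1 : (i:ℝ) < (j:ℝ)+1 := lt_of_mul_lt_mul_right (h2.1.trans h.2) hTN.le
    have a2 : (j:ℝ) < (i:ℝ)+1 := lt_of_mul_lt_mul_right (h.1.trans h2.2) hTN.le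
    have b1 : (i:ℕ) < j + 1 := by exact_mod_cast a1
    have b2 : (j:ℕ) < i + 1 := by exact_mod_cast a2
    exact Fin.ext (by omega)
  · simp

/-- `L²⋆(0, T)_N`: the functions that are piecewise constant on the grid with `N` cells. -/
def stepFunctions (T : ℝ) (N : ℕ) : Set (L2star T) := {u | ∃ v : Fin N → ℝ, IsStep N v u}

/-- The discretization `U_N` of `U ⊆ L²⋆(0, T)`. -/
def discretize {T : ℝ} (U : Set (L2star T)) (N : ℕ) : Set (L2star T) := U ∩ stepFunctions T N

/-- The discretization of a subset of `L²⋆(0, T)^n`. -/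
def discretizeTuple {T : ℝ} {n : ℕ} (V : Set (Fin n → L2star T)) (N : ℕ) :
    Set (Fin n → L2star T) := {x | x ∈ V ∧ ∀ c, x c ∈ stepFunctions T N}

/-! ### Extended formulations -/

/-- The two shapes `L(x) ≥ 0` a.e. in `(0, T)` and `D L(x) ≥ 0` of a linear constraint. -/
inductive ConstraintKind : Type
  | value
  | derivative

/-- A linear constraint on `x = (u, z₁, …, z_d) ∈ L²⋆(0, T)^(d+1)`, given by a continuous
affine-linear operator. -/
structure LinearConstraint (T : ℝ) (d : ℕ) : Type where
  op : (Fin (d + 1) → L2star T) →ᴬ[ℝ] L2star T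
  kind : ConstraintKind

/-- The tuple `x` satisfies the constraint. -/
def LinearConstraint.Holds {T : ℝ} {d : ℕ} (C : LinearConstraint T d)
    (x : Fin (d + 1) → L2star T) : Prop :=
  match C.kind with
  | .value => ∀ᵐ t ∂(volume.restrict (Ioo 0 T)), 0 ≤ rep (C.op x) t
  | .derivative => DerivLE 0 (C.op x)

/-- `V ⊆ L²⋆(0, T)^(d+1)`, described by the finite list `S` of linear constraints, is an extended
formulation of `U ⊆ BV⋆(0, T)`. -/
structure IsExtendedFormulation {T : ℝ} {d : ℕ} (U : Set (L2star T))
    (V : Set (Fin (d + 1) → L2star T)) (S : List (LinearConstraint T d)) : Prop where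
  subset_BV : U ⊆ BVstarIn T univ
  projection : (fun x : Fin (d + 1) → L2star T => x 0) '' V = closure (convexHull ℝ U)
  linear : V = {x | ∀ C ∈ S, C.Holds x}

/-! Smallness and compatibility are properties of a whole class of instances `p : ι`, each given
by a finite input through the encoding `enc`; the instance `p` has the time horizon `[0, T p]`. -/

/-- The number of controls and the number of constraints are bounded by a polynomial in the size
of the input. -/
def IsSmall {ι Γ : Type} (enc : Encoding ι Γ) (T : ι → ℝ) (d : ι → ℕ)
    (S : ∀ p, List (LinearConstraint (T p) (d p))) : Prop :=
  ∃ P : Polynomial ℕ, ∀ p,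
    d p + 1 ≤ P.eval (enc.encode p).length ∧ (S p).length ≤ P.eval (enc.encode p).length

/-- Rational numbers, encoded by sign, absolute value of the numerator, and denominator, the
latter two in binary. -/
def encodingRat : Encoding ℚ (Bool ⊕ Bool ⊕ Bool) where
  encode q := (encodingProd encodingBoolBool (encodingProd encodingNatBool encodingNatBool)).encode
    (decide (q.num < 0), q.num.natAbs, q.den)
  decode l :=
    ((encodingProd encodingBoolBool (encodingProd encodingNatBool encodingNatBool)).decode l).map
      fun x => (if x.1 then -(x.2.1 : ℚ) else (x.2.1 : ℚ)) / (x.2.2 : ℚ)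
  decode_encode q := by
    rw [Encoding.decode_encode, Option.map_some]
    congr 1
    conv_rhs => rw [← Rat.num_div_den q]
    congr 1
    by_cases h : q.num < 0
    · have h1 : ((q.num.natAbs : ℕ) : ℤ) = -q.num := by omega
      have h2 : ((q.num.natAbs : ℕ) : ℚ) = -(q.num : ℚ) := by
        rw [← Int.cast_natCast, h1]; push_cast; rfl
      simp [h, h2]
    · have h1 : ((q.num.natAbs : ℕ) : ℤ) = q.num := by omega
      have h2 : ((q.num.natAbs : ℕ) : ℚ) = (q.num : ℚ) := by
        rw [← Int.cast_natCast, h1]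
      simp [h, h2]

/-- The function `f` can be computed in polynomial time by a Turing machine. -/
def PolyTime {α β Γ₀ Γ₁ : Type} (ea : Encoding α Γ₀) (eb : Encoding β Γ₁) (f : α → β) : Prop :=
  Nonempty (Turing.TM2ComputableInPolyTime ea.encode eb.encode f)

/-- Encoding of an instance `p` followed by `N, k, i` in binary. -/
def encodingConstQuery {ι Γ : Type} (enc : Encoding ι Γ) :
    Encoding (ι × ℕ × ℕ × ℕ) (Γ ⊕ Bool ⊕ Bool ⊕ Bool) :=
  encodingProd enc (encodingProd encodingNatBool (encodingProd encodingNatBool encodingNatBool))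

/-- Encoding of an instance `p` followed by `N, k, i, c, j` in binary. -/
def encodingMatrixQuery {ι Γ : Type} (enc : Encoding ι Γ) :
    Encoding (ι × ℕ × ℕ × ℕ × ℕ × ℕ) (Γ ⊕ Bool ⊕ Bool ⊕ Bool ⊕ Bool ⊕ Bool) :=
  encodingProd enc (encodingProd encodingNatBool (encodingProd encodingNatBool
    (encodingProd encodingNatBool (encodingProd encodingNatBool encodingNatBool))))

/-- Compatibility with discretization of the extended formulations `V p` of `U p`, described by
the constraints `S p`.  In `coefficients`, the restriction of the `k`-th operator to tuples of
piecewise constant functions on `N` cells is identified with an affine-linear map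
`ℝ^((d+1)N) → ℝ^N`; its linear part has the entry `A (p, N, k, i, c, j)` in row `i` and at the
`j`-th cell of the `c`-th control, and its constant part is `b (p, N, k, i)`.  Turing
machines that serve all instances and all `N` compute these numbers from `p` and the indices, in
polynomial time. -/
structure CompatibleWithDiscretization {ι Γ : Type} (enc : Encoding ι Γ) (T : ι → ℝ) (d : ι → ℕ)
    (U : ∀ p, Set (L2star (T p))) (V : ∀ p, Set (Fin (d p + 1) → L2star (T p)))
    (S : ∀ p, List (LinearConstraint (T p) (d p))) : Prop where
  projection : ∀ p, ∀ N : ℕ, 0 < N →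
    (fun x : Fin (d p + 1) → L2star (T p) => x 0) '' discretizeTuple (V p) N =
      convexHull ℝ (discretize (U p) N)
  mapsTo : ∀ p, ∀ N : ℕ, 0 < N → ∀ C ∈ S p, ∀ x : Fin (d p + 1) → L2star (T p),
    (∀ c, x c ∈ stepFunctions (T p) N) → C.op x ∈ stepFunctions (T p) N
  coefficients : ∃ (A : ι × ℕ × ℕ × ℕ × ℕ × ℕ → ℚ) (b : ι × ℕ × ℕ × ℕ → ℚ),
    PolyTime (encodingMatrixQuery enc) encodingRat A ∧
    PolyTime (encodingConstQuery enc) encodingRat b ∧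
    ∀ p, ∀ N : ℕ, 0 < N → ∀ k : Fin (S p).length,
      ∀ (v : Fin (d p + 1) → Fin N → ℝ) (x : Fin (d p + 1) → L2star (T p)),
        (∀ c, IsStep N (v c) (x c)) →
        IsStep N
          (fun i => (∑ c : Fin (d p + 1), ∑ j : Fin N,
              (A (p, N, (k : ℕ), (i : ℕ), (c : ℕ), (j : ℕ)) : ℝ) * v c j) +
            (b (p, N, (k : ℕ), (i : ℕ)) : ℝ))
          (((S p).get k).op x)

/-! ### Switches with bounded variation -/

/-- `U(σ)`: the binary switches on `[0, T]` with variation at most `σ`. -/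
def switches (T : ℝ) (σ : ℕ) : Set (L2star T) :=
  {u | u ∈ BVstarIn T {0, 1} ∧ variation u ≤ (σ : ℝ≥0∞)}

/-- `U(σ)^ext`: the pairs `(u, z)` with `u ∈ L²⋆(0,T;[0,1])`, `z ∈ L²⋆(0,T;[0,σ/2])`,
`Dz ≥ Du` and `Dz ≥ 0`. -/
def switchesExt (T : ℝ) (σ : ℕ) : Set (Fin (1 + 1) → L2star T) :=
  {x | x 0 ∈ L2starIn T (Icc 0 1) ∧ x 1 ∈ L2starIn T (Icc 0 ((σ : ℝ) / 2)) ∧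
    DerivLE (x 0) (x 1) ∧ DerivLE 0 (x 1)}

/-- An instance: a rational time horizon `T > 0` and an even bound `σ` on the variation. -/
structure EvenInstance : Type where
  T : ℚ
  T_pos : 0 < T
  σ : ℕ
  even_σ : Even σ

/-- The input `(T, σ)` in binary. -/
def encodingEvenInstance : Encoding EvenInstance ((Bool ⊕ Bool ⊕ Bool) ⊕ Bool) where
  encode p := (encodingProd encodingRat encodingNatBool).encode (p.T, p.σ)
  decode l := ((encodingProd encodingRat encodingNatBool).decode l).bind fun x =>
    if h : 0 < x.1 ∧ Even x.2 then some ⟨x.1, h.1, x.2, h.2⟩ else none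
  decode_encode p := by
    rw [Encoding.decode_encode, Option.bind_some, dif_pos ⟨p.T_pos, p.even_σ⟩]

end

end Switching

/-! The auxiliary control `z` counts the upward jumps of `u`, and `w = z - u` counts the downward
ones. The constraints say that both are non-decreasing and that `z ≤ m`, where `σ = 2m`.

From pairs to switches (`exists_convexHull_near`): since `0 ≤ u ≤ 1`, one has `w ≤ z ≤ w + 1`. For a
shift `θ ∈ [0,1)` the function `⌊z + θ⌋ - ⌊w + θ⌋` therefore has values in `{0,1}`. It is a
difference of monotone functions with integer values between `0` and `m`, so its variation is at
most `2m` (`variation_le_of_sub`). The average over all `θ` is `z - w = u`. With the shifts `j/M`,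
`j < M`, Hermite's identity shows that the average differs from `u` by at most `1/M` on `(0,T)`;
letting `M → ∞` puts `u` in the closed convex hull. Rounding acts pointwise, so it preserves the
grid. On a grid there are finitely many switches, and their hull is already closed.

From switches to pairs (`exists_mem_switchesExt`): for a switch `u` let `z` be its number of upward
jumps. As `u` is only an a.e. class, the jumps are counted on a set of full measure of points where
testing against smoothed jumps recovers `u`. If `u` jumps up `k + 1` times, a test function
oscillating between `1` and `-1` shows that the variation is at least `2k + 1`
(`UpChain.le_variation`); the last downward jump may be missing before `T`. Since `σ = 2m` is even,
`2k + 1 ≤ 2m` still gives `k + 1 ≤ m`.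

The projection is convex, and it is closed because the controls `z` are bounded and all constraints
survive weak limits (`isClosed_projection`). Hence it contains the closed convex hull.

The six operators act pointwise. On a grid their linear parts are multiples of identity matrices
with factors in `{0, 1, -1, -2}`, and their constants are `0`, `1` or `σ`. A machine needs only to
recognize the indices `k` and `c`, to compare `i` with `j`, and to copy the digits of `σ`. -/

namespace Switching

open Turing StateTransition

/-! ### A Turing machine that scans, compares and copies -/

/-- The stacks of a scanning machine. -/
inductive ScanStack : Type
  | input
  | left
  | right
  | output
  deriving DecidableEq

instance : Fintype ScanStack :=
  ⟨{.input, .left, .right, .output}, by rintro (_ | _ | _ | _) <;> simp⟩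

/-- The two loops of a scanning machine. -/
inductive ScanLabel : Type
  | scan
  | compare
  deriving DecidableEq

instance : Fintype ScanLabel :=
  ⟨{.scan, .compare}, by rintro (_ | _) <;> simp⟩

/-- The data of a scanning machine. It reads its input with the finite automaton
`(initial, next)` and stores the bits selected by `left` and `right` on two stacks. It then
compares these stacks, and prints a rational number with denominator one: the numerator is the
content of the left stack if `copy` holds, preceded by the digits of `1` or `2`, if required by `one` and `two`,
with a sign given by `neg`. -/
structure ScanProgram (Γ Q : Type) : Type where
  initial : Q
  next : Q → Γ → Q
  left : Γ → Option Bool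
  right : Γ → Option Bool
  copy : Q → Bool
  one : Q → Bool → Bool
  two : Q → Bool → Bool
  neg : Q → Bool → Bool

/-- The alphabets of the stacks of a scanning machine. -/
abbrev ScanAlphabet (Γ : Type) : ScanStack → Type
  | .input => Γ
  | .left => Bool
  | .right => Bool
  | .output => Bool ⊕ Bool ⊕ Bool

instance (Γ : Type) [Fintype Γ] : ∀ k, Fintype (ScanAlphabet Γ k)
  | .input => inferInstanceAs (Fintype Γ)
  | .left => inferInstanceAs (Fintype Bool)
  | .right => inferInstanceAs (Fintype Bool)
  | .output => inferInstanceAs (Fintype (Bool ⊕ Bool ⊕ Bool))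

/-- The stacks with given contents. -/
def scanStacks {Γ : Type} (l : List Γ) (x y : List Bool) (o : List (Bool ⊕ Bool ⊕ Bool)) :
    ∀ k, List (ScanAlphabet Γ k)
  | .input => l
  | .left => x
  | .right => y
  | .output => o

section ScanStacks

variable {Γ : Type} (l l' : List Γ) (x x' y y' : List Bool) (o o' : List (Bool ⊕ Bool ⊕ Bool))

theorem update_scanStacks_input :
    Function.update (scanStacks l x y o) .input l' = scanStacks l' x y o := by
  funext k; cases k <;> rfl

theorem update_scanStacks_left :
    Function.update (scanStacks l x y o) .left x' = scanStacks l x' y o := by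
  funext k; cases k <;> rfl

theorem update_scanStacks_right :
    Function.update (scanStacks l x y o) .right y' = scanStacks l x y' o := by
  funext k; cases k <;> rfl

theorem update_scanStacks_output :
    Function.update (scanStacks l x y o) .output o' = scanStacks l x y o' := by
  funext k; cases k <;> rfl

end ScanStacks

/-- Push a symbol if there is one. -/
def pushOption {K : Type} {Γ : K → Type} {Λ σ : Type} (k : K) (f : σ → Option (Γ k)) (a : Γ k)
    (q : TM2.Stmt Γ Λ σ) : TM2.Stmt Γ Λ σ :=
  .branch (fun s => (f s).isSome) (.push k (fun s => (f s).getD a) q) q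

theorem stepAux_pushOption {K : Type} [DecidableEq K] {Γ : K → Type} {Λ σ : Type} (k : K)
    (f : σ → Option (Γ k)) (a : Γ k) (q : TM2.Stmt Γ Λ σ) (v : σ) (S : ∀ k, List (Γ k)) :
    TM2.stepAux (pushOption k f a q) v S =
      TM2.stepAux q v (Function.update S k ((f v).toList ++ S k)) := by
  unfold pushOption
  rcases h : f v with _ | b <;> simp [h]

/-- The internal state of a scanning machine: a state of the automaton, the result of the
comparison so far, and the symbols read most recently from the input and the two inner stacks. -/
structure ScanState (Γ Q : Type) : Type where
  q : Q
  same : Bool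
  sym : Option Γ
  x : Option Bool
  y : Option Bool

noncomputable instance (Γ Q : Type) [Fintype Γ] [Fintype Q] : Fintype (ScanState Γ Q) :=
  Fintype.ofInjective
    (fun s : ScanState Γ Q => (s.q, s.same, s.sym, s.x, s.y)) (by
      rintro ⟨⟩ ⟨⟩ h
      simpa using h)

namespace ScanProgram

variable {Γ Q : Type} (P : ScanProgram Γ Q)

/-- The initial state. -/
def start : ScanState Γ Q := ⟨P.initial, true, none, none, none⟩

/-- The program of a scanning machine. -/
def program : ScanLabel → TM2.Stmt (ScanAlphabet Γ) ScanLabel (ScanState Γ Q)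
  | .scan =>
    .pop .input (fun s a => { s with sym := a }) <|
    .branch (fun s => s.sym.isNone)
      -- The output is a stack and is written from its end: denominator `1`, then the numerator, and
      -- the sign on top.
      (.push .output (fun _ => .inr (.inr true)) <|
        .goto fun _ => .compare)
      (pushOption .left (fun s => s.sym.bind P.left) true <|
        pushOption .right (fun s => s.sym.bind P.right) true <|
        .load (fun s => { s with q := s.sym.elim s.q (P.next s.q), sym := none }) <|
        .goto fun _ => .scan)
  | .compare =>
    .pop .left (fun s a => { s with x := a }) <|
    .pop .right (fun s a => { s with y := a }) <|
    .branch (fun s => s.x.isNone && s.y.isNone)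
      (pushOption .output
          (fun s => if P.one s.q s.same then some (.inr (.inl true)) else none)
          (.inl true) <|
        pushOption .output
          (fun s => if P.two s.q s.same then some (.inr (.inl false)) else none)
          (.inl true) <|
        .push .output (fun s => .inl (P.neg s.q s.same)) <|
        -- A halting configuration must carry the initial state and empty work stacks. For the same
        -- reason the comparison loop goes on after a mismatch until both stacks are exhausted.
        .load (fun _ => P.start) <|
        .halt)
      (pushOption .output
          (fun s => if P.copy s.q then s.x.map (fun b => .inr (.inl b)) else none) (.inl true) <|
        .load (fun s => { s with same := s.same && (s.x == s.y), x := none, y := none }) <|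
        .goto fun _ => .compare)

/-- The scanning machine as a Turing machine. -/
noncomputable def machine [Fintype Γ] [Fintype Q] : FinTM2 where
  K := ScanStack
  k₀ := .input
  k₁ := .output
  Γ := ScanAlphabet Γ
  Λ := ScanLabel
  main := .scan
  σ := ScanState Γ Q
  initialState := P.start
  Γk₀Fin := inferInstanceAs (Fintype (ScanAlphabet Γ .input))
  m := P.program

/-- The machine runs from one configuration to another in exactly `n` steps. -/
abbrev Runs (n : ℕ) (a b : TM2.Cfg (ScanAlphabet Γ) ScanLabel (ScanState Γ Q)) : Prop :=
  (flip bind (TM2.step P.program))^[n] (some a) = some b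

variable {P}

theorem Runs.trans {m n : ℕ} {a b c : TM2.Cfg (ScanAlphabet Γ) ScanLabel (ScanState Γ Q)}
    (h₁ : P.Runs m a b) (h₂ : P.Runs n b c) : P.Runs (n + m) a c := by
  unfold Runs at *
  rw [Function.iterate_add_apply, h₁, h₂]

variable (P)

theorem runs_one_iff {a b : TM2.Cfg (ScanAlphabet Γ) ScanLabel (ScanState Γ Q)} :
    P.Runs 1 a b ↔ TM2.step P.program a = some b := Iff.rfl

theorem runs_scan_cons (q : Q) (a : Γ) (l : List Γ) (x y : List Bool)
    (o : List (Bool ⊕ Bool ⊕ Bool)) :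
    P.Runs 1 ⟨some .scan, ⟨q, true, none, none, none⟩, scanStacks (a :: l) x y o⟩
      ⟨some .scan, ⟨P.next q a, true, none, none, none⟩,
        scanStacks l ((P.left a).toList ++ x) ((P.right a).toList ++ y) o⟩ := by
  rw [runs_one_iff]
  simp only [TM2.step, program, TM2.stepAux, stepAux_pushOption, update_scanStacks_input]
  simp [scanStacks, update_scanStacks_left, update_scanStacks_right]

theorem runs_scan (l : List Γ) (q : Q) (x y : List Bool) :
    P.Runs (l.length + 1) ⟨some .scan, ⟨q, true, none, none, none⟩, scanStacks l x y []⟩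
      ⟨some .compare, ⟨l.foldl P.next q, true, none, none, none⟩,
        scanStacks [] ((l.filterMap P.left).reverse ++ x) ((l.filterMap P.right).reverse ++ y)
          [.inr (.inr true)]⟩ := by
  induction l generalizing q x y with
  | nil =>
    rw [List.length_nil, zero_add, runs_one_iff]
    simp only [TM2.step, program, TM2.stepAux, update_scanStacks_input]
    simp [scanStacks, update_scanStacks_output]
  | cons a l ih =>
    have h : ∀ (f : Γ → Option Bool) (x : List Bool), ((a :: l).filterMap f).reverse ++ x =
        (l.filterMap f).reverse ++ ((f a).toList ++ x) := by
      intro f x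
      rcases hf : f a with _ | b <;> simp [hf]
    rw [h, h]
    exact (P.runs_scan_cons q a l x y []).trans (ih _ _ _)

/-- The digits that are copied to the output. -/
def copied (q : Q) (x : List Bool) : List (Bool ⊕ Bool ⊕ Bool) :=
  if P.copy q then x.map fun b => .inr (.inl b) else []

/-- The output, once the comparison is finished. -/
def finish (q : Q) (same : Bool) (o : List (Bool ⊕ Bool ⊕ Bool)) : List (Bool ⊕ Bool ⊕ Bool) :=
  .inl (P.neg q same) ::
    ((if P.two q same then [.inr (.inl false)] else []) ++
      ((if P.one q same then [.inr (.inl true)] else []) ++ o))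

theorem runs_compare_nil (q : Q) (same : Bool) (o : List (Bool ⊕ Bool ⊕ Bool)) :
    P.Runs 1 ⟨some .compare, ⟨q, same, none, none, none⟩, scanStacks [] [] [] o⟩
      ⟨none, P.start, scanStacks [] [] [] (P.finish q same o)⟩ := by
  rw [runs_one_iff]
  simp only [TM2.step, program, TM2.stepAux, stepAux_pushOption, update_scanStacks_left,
    update_scanStacks_right, update_scanStacks_output]
  cases h₁ : P.one q same <;> cases h₂ : P.two q same <;>
    simp [scanStacks, finish, h₁, h₂]

theorem runs_compare_step (q : Q) (same : Bool) (x y : List Bool) (o : List (Bool ⊕ Bool ⊕ Bool))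
    (h : x ≠ [] ∨ y ≠ []) :
    P.Runs 1 ⟨some .compare, ⟨q, same, none, none, none⟩, scanStacks [] x y o⟩
      ⟨some .compare, ⟨q, same && (x.head? == y.head?), none, none, none⟩,
        scanStacks [] x.tail y.tail (P.copied q x.head?.toList ++ o)⟩ := by
  rw [runs_one_iff]
  have h' : (x.head?.isNone && y.head?.isNone) = false := by
    rcases h with h | h
    · obtain ⟨a, x, rfl⟩ := List.exists_cons_of_ne_nil h; simp
    · obtain ⟨a, y, rfl⟩ := List.exists_cons_of_ne_nil h; simp
  simp only [TM2.step, program, TM2.stepAux, update_scanStacks_left]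
  simp only [scanStacks, update_scanStacks_right, h', cond_false, stepAux_pushOption,
    TM2.stepAux, update_scanStacks_output]
  cases h₁ : P.copy q <;> cases x <;> simp [copied, h₁]

/-- Popping reverses the copied digits; as the scan has stored them in reverse, their original order
is restored. An exhausted stack is read as `none`, so different lengths count as a mismatch. -/
theorem runs_compare : ∀ (x y : List Bool) (q : Q) (same : Bool) (o : List (Bool ⊕ Bool ⊕ Bool)),
    P.Runs (max x.length y.length + 1)
      ⟨some .compare, ⟨q, same, none, none, none⟩, scanStacks [] x y o⟩
      ⟨none, P.start, scanStacks [] [] []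
        (P.finish q (same && decide (x = y)) (P.copied q x.reverse ++ o))⟩
  | [], [], q, same, o => by simpa [copied] using P.runs_compare_nil q same o
  | a :: x, [], q, same, o => by
    have := (P.runs_compare_step q same (a :: x) [] o (by simp)).trans (runs_compare x [] _ _ _)
    cases h : P.copy q <;> simpa [copied, h] using this
  | [], b :: y, q, same, o => by
    have := (P.runs_compare_step q same [] (b :: y) o (by simp)).trans (runs_compare [] y _ _ _)
    cases h : P.copy q <;> simpa [copied, h] using this
  | a :: x, b :: y, q, same, o => by
    have := (P.runs_compare_step q same (a :: x) (b :: y) o (by simp)).trans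
      (runs_compare x y _ _ _)
    have e : (same && (some a == some b) && decide (x = y)) =
        (same && decide (a :: x = b :: y)) := by
      rw [Bool.and_assoc]; congr 1; by_cases h : a = b <;> simp [h]
    simp only [List.head?_cons, e] at this
    cases h : P.copy q <;> simpa [copied, h, Nat.succ_max_succ] using this

/-- The output of a scanning machine. -/
def result (l : List Γ) : List (Bool ⊕ Bool ⊕ Bool) :=
  P.finish (l.foldl P.next P.initial) (decide (l.filterMap P.left = l.filterMap P.right))
    (P.copied (l.foldl P.next P.initial) (l.filterMap P.left) ++ [.inr (.inr true)])

/-- A function whose values are printed by a scanning machine can be computed in polynomial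
time. -/
theorem polyTime [Fintype Γ] [Fintype Q] {α : Type} (e : Encoding α Γ) (f : α → ℚ)
    (h : ∀ a, encodingRat.encode (f a) = P.result (e.encode a)) : PolyTime e encodingRat f := by
  refine ⟨{ tm := P.machine, inputAlphabet := Equiv.refl Γ, outputAlphabet := Equiv.refl _,
            -- The scan takes `l.length + 1` steps. The comparison takes at most as many, since each
            -- inner stack holds a selection of the input symbols.
            time := 2 * Polynomial.X + 2, outputsFun := fun a => ?_ }⟩
  set l := e.encode a with hl
  have hrun := (P.runs_scan l P.initial [] []).trans (P.runs_compare _ _ _ _ _)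
  simp only [List.append_nil, List.length_reverse, List.reverse_reverse, List.reverse_inj,
    Bool.true_and] at hrun
  refine ⟨⟨max (l.filterMap P.left).length (l.filterMap P.right).length + 1 + (l.length + 1),
    ?_⟩, ?_⟩
  · have h1 : initList P.machine (List.map (Equiv.refl Γ).invFun l) =
        ⟨some .scan, P.start, scanStacks l [] [] []⟩ := by
      unfold initList
      congr 1
      funext k
      cases k
      · show List.map id l = l
        simp
      all_goals rfl
    have h2 : haltList P.machine (List.map (Equiv.refl (Bool ⊕ Bool ⊕ Bool)).invFun
          (encodingRat.encode (f a))) =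
        ⟨none, P.start, scanStacks [] [] [] (P.result l)⟩ := by
      rw [h a]
      unfold haltList
      congr 1
      funext k
      cases k
      case output =>
        show List.map id _ = P.result l
        rw [List.map_id]
      all_goals rfl
    refine (congrArg _ (congrArg some h1)).trans (Eq.trans ?_ (congrArg some h2).symm)
    exact hrun
  · have h1 := List.length_filterMap_le P.left l
    have h2 := List.length_filterMap_le P.right l
    simp only [Polynomial.eval_add, Polynomial.eval_mul, Polynomial.eval_X,
      Polynomial.eval_ofNat]
    omega

end ScanProgram

/-! ### The coefficients of the constraints -/

/-- The coefficient of `u` in the `k`-th constraint. -/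
def controlCoeff : ℕ → ℤ
  | 0 => 1
  | 1 => -1
  | 4 => -1
  | _ => 0

/-- The coefficient of `z` in the `k`-th constraint. -/
def counterCoeff : ℕ → ℤ
  | 2 => 1
  -- The bound `z ≤ σ/2` is doubled to `σ - 2z ≥ 0`: all coefficients are integers and the constant
  -- is `σ` itself, whose digits can be copied.
  | 3 => -2
  | 4 => 1
  | 5 => 1
  | _ => 0

/-- The constant in the `k`-th constraint. -/
def constCoeff (σ : ℕ) : ℕ → ℕ
  | 1 => 1
  | 3 => σ
  | _ => 0

/-- The last three bits of a string. -/
abbrev Register : Type := Option Bool × Option Bool × Option Bool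

/-- Append a bit to the register. -/
def Register.shift (r : Register) (b : Bool) : Register := (r.2.1, r.2.2, some b)

/-- The register after reading a number in binary. -/
def Register.read (n : ℕ) : Register := (encodeNat n).foldl Register.shift (none, none, none)

/-- The number in a register, if it is less than six. -/
def Register.toNat : Register → ℕ
  | (none, none, none) => 0
  | (none, none, some true) => 1
  | (none, some false, some true) => 2
  | (none, some true, some true) => 3
  | (some false, some false, some true) => 4
  | (some true, some false, some true) => 5
  | _ => 6

/-- Such a number has at most three binary digits, so nothing is shifted out. Larger numbers may
collide (`8` leaves the same register as `4`), which does no harm because there are only six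
constraints. -/
theorem Register.toNat_read {n : ℕ} (hn : n < 6) : (Register.read n).toNat = n := by
  interval_cases n <;> decide

theorem encodeRat_intCast (n : ℤ) : encodingRat.encode (n : ℚ) =
    .inl (decide (n < 0)) ::
      ((encodeNat n.natAbs).map (fun b => .inr (.inl b)) ++ [.inr (.inr true)]) := by
  have h1 : encodeNat 1 = [true] := by decide
  simp [encodingRat, encodingProd, encodingBoolBool, encodingNatBool, encodeBool, h1]

/-- The registers for the number of the constraint and for that of the control. -/
abbrev QueryState : Type := Register × Register

/-- The linear coefficient described by the registers for `k` and `c`. -/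
def entryCoeff (q : QueryState) : ℤ :=
  if q.2.toNat = 0 then controlCoeff q.1.toNat else counterCoeff q.1.toNat

/-- The list of possible values is what allows the finite control to print the coefficient. -/
theorem entryCoeff_mem (q : QueryState) :
    entryCoeff q = 0 ∨ entryCoeff q = 1 ∨ entryCoeff q = -1 ∨ entryCoeff q = -2 := by
  unfold entryCoeff controlCoeff counterCoeff
  split_ifs <;> split <;> simp

/-- The scanning program for the linear coefficients. -/
def matrixProgram {Γ : Type} :
    ScanProgram (Γ ⊕ Bool ⊕ Bool ⊕ Bool ⊕ Bool ⊕ Bool) QueryState where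
  initial := ((none, none, none), (none, none, none))
  next
    | q, .inr (.inr (.inl b)) => (q.1.shift b, q.2)
    | q, .inr (.inr (.inr (.inr (.inl b)))) => (q.1, q.2.shift b)
    | q, _ => q
  left
    | .inr (.inr (.inr (.inl b))) => some b
    | _ => none
  right
    | .inr (.inr (.inr (.inr (.inr b)))) => some b
    | _ => none
  copy _ := false
  -- Digits are written lowest first, so `2` is `[false, true]`: the digit `true` is needed for `-2`
  -- as well, with `false` pushed on top of it.
  one q same := same && decide (entryCoeff q ≠ 0)
  two q same := same && decide (entryCoeff q = -2)
  neg q same := same && decide (entryCoeff q < 0)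

/-- The scanning program for the constant coefficients. -/
def constProgram {Γ : Type} : ScanProgram ((Γ ⊕ Bool) ⊕ Bool ⊕ Bool ⊕ Bool) Register where
  initial := (none, none, none)
  next
    | q, .inr (.inr (.inl b)) => q.shift b
    | q, _ => q
  left
    | .inl (.inr b) => some b
    | _ => none
  right _ := none
  copy q := decide (q.toNat = 3)
  one q _ := decide (q.toNat = 1)
  two _ _ := false
  neg _ _ := false

theorem matrixProgram_foldl {ι Γ : Type} (enc : Encoding ι Γ) (p : ι) (N k i c j : ℕ) :
    ((encodingMatrixQuery enc).encode (p, N, k, i, c, j)).foldl matrixProgram.next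
      (matrixProgram (Γ := Γ)).initial = (Register.read k, Register.read c) := by
  have hfst : ∀ (l : List Bool) (q : QueryState),
      l.foldl (fun q b => (q.1.shift b, q.2)) q = (l.foldl Register.shift q.1, q.2) := by
    intro l
    induction l with
    | nil => exact fun q => rfl
    | cons b l ih => exact fun q => ih _
  have hsnd : ∀ (l : List Bool) (q : QueryState),
      l.foldl (fun q b => (q.1, q.2.shift b)) q = (q.1, l.foldl Register.shift q.2) := by
    intro l
    induction l with
    | nil => exact fun q => rfl
    | cons b l ih => exact fun q => ih _
  simp only [encodingMatrixQuery, encodingProd, List.map_append, List.map_map,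
    List.foldl_append, List.foldl_map, Function.comp_apply, matrixProgram, encodingNatBool]
  simp only [List.foldl_fixed, hfst, hsnd]
  rfl

theorem matrixProgram_left {ι Γ : Type} (enc : Encoding ι Γ) (p : ι) (N k i c j : ℕ) :
    ((encodingMatrixQuery enc).encode (p, N, k, i, c, j)).filterMap matrixProgram.left =
      encodeNat i := by
  simp [encodingMatrixQuery, encodingProd, matrixProgram, encodingNatBool,
    List.filterMap_append, List.filterMap_map, Function.comp_def]

theorem matrixProgram_right {ι Γ : Type} (enc : Encoding ι Γ) (p : ι) (N k i c j : ℕ) :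
    ((encodingMatrixQuery enc).encode (p, N, k, i, c, j)).filterMap matrixProgram.right =
      encodeNat j := by
  simp [encodingMatrixQuery, encodingProd, matrixProgram, encodingNatBool,
    List.filterMap_append, List.filterMap_map, Function.comp_def]

/-- A pointwise operator has a multiple of the identity as its matrix, so apart from a table lookup
in `k` and `c` only the equality of `i` and `j` must be decided. This is the comparison of the two
inner stacks. -/
theorem polyTime_matrix {ι Γ : Type} [Fintype Γ] (enc : Encoding ι Γ) :
    PolyTime (encodingMatrixQuery enc) encodingRat fun x : ι × ℕ × ℕ × ℕ × ℕ × ℕ =>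
      ((if x.2.2.2.1 = x.2.2.2.2.2 then
        entryCoeff (Register.read x.2.2.1, Register.read x.2.2.2.2.1) else 0 : ℤ) : ℚ) := by
  refine matrixProgram.polyTime _ _ ?_
  rintro ⟨p, N, k, i, c, j⟩
  have hinj : encodeNat i = encodeNat j ↔ i = j := encodingNatBool.encode_injective.eq_iff
  rw [ScanProgram.result, matrixProgram_foldl, matrixProgram_left, matrixProgram_right,
    encodeRat_intCast]
  simp only [hinj, ScanProgram.finish, ScanProgram.copied, matrixProgram]
  have h0 : encodeNat 0 = [] := by decide
  have h1 : encodeNat 1 = [true] := by decide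
  have h2 : encodeNat 2 = [false, true] := by decide
  by_cases hij : i = j
  · simp only [hij, if_true, decide_true, Bool.true_and]
    rcases entryCoeff_mem (Register.read k, Register.read c) with h | h | h | h <;>
      simp [h, h0, h1, h2]
  · simp [hij, h0]

theorem constProgram_foldl {ι Γ : Type} (enc : Encoding ι (Γ ⊕ Bool)) (p : ι) (N k i : ℕ) :
    ((encodingConstQuery enc).encode (p, N, k, i)).foldl constProgram.next
      (constProgram (Γ := Γ)).initial = Register.read k := by
  simp only [encodingConstQuery, encodingProd, List.map_append, List.map_map,
    List.foldl_append, List.foldl_map, Function.comp_apply, constProgram, encodingNatBool]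
  simp only [List.foldl_fixed]
  rfl

theorem constProgram_left (p : EvenInstance) (N k i : ℕ) :
    ((encodingConstQuery encodingEvenInstance).encode (p, N, k, i)).filterMap constProgram.left =
      encodeNat p.σ := by
  simp [encodingConstQuery, encodingEvenInstance, encodingProd, constProgram, encodingNatBool,
    List.filterMap_append, List.filterMap_map, Function.comp_def]

/-- The only unbounded constant is `σ`, which stands in binary in the input and is copied digit by
digit. -/
theorem polyTime_const :
    PolyTime (encodingConstQuery encodingEvenInstance) encodingRat
      fun x : EvenInstance × ℕ × ℕ × ℕ =>
        ((constCoeff x.1.σ (Register.read x.2.2.1).toNat : ℤ) : ℚ) := by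
  refine constProgram.polyTime _ _ ?_
  rintro ⟨p, N, k, i⟩
  rw [ScanProgram.result, constProgram_foldl, constProgram_left, encodeRat_intCast]
  have h0 : encodeNat 0 = [] := by decide
  have h1 : encodeNat 1 = [true] := by decide
  simp only [ScanProgram.finish, ScanProgram.copied, constProgram, Int.natAbs_natCast]
  by_cases hn1 : (Register.read k).toNat = 1
  · simp [hn1, constCoeff, h1]
  by_cases hn3 : (Register.read k).toNat = 3
  · simp [hn3, constCoeff]
  have : constCoeff p.σ (Register.read k).toNat = 0 := by
    unfold constCoeff; split <;> simp_all
  simp [hn1, hn3, this, h0]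

open Filter Topology

noncomputable section

/-! ### Representatives -/

variable {T : ℝ}

theorem memLp_rep (u : L2star T) : MemLp (rep u) 2 (volume.restrict (Iio T)) := Lp.memLp _

theorem rep_eq_zero_of_neg (u : L2star T) :
    ∀ᵐ t ∂(volume.restrict (Iio T)), t < 0 → rep u t = 0 := u.2

theorem rep_add (u v : L2star T) :
    rep (u + v) =ᵐ[volume.restrict (Iio T)] fun t => rep u t + rep v t :=
  Lp.coeFn_add (u : L2 T) (v : L2 T)

theorem rep_sub (u v : L2star T) :
    rep (u - v) =ᵐ[volume.restrict (Iio T)] fun t => rep u t - rep v t :=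
  Lp.coeFn_sub (u : L2 T) (v : L2 T)

theorem rep_smul (c : ℝ) (u : L2star T) :
    rep (c • u) =ᵐ[volume.restrict (Iio T)] fun t => c * rep u t :=
  Lp.coeFn_smul c (u : L2 T)

theorem rep_ext {u v : L2star T} (h : rep u =ᵐ[volume.restrict (Iio T)] rep v) : u = v :=
  Subtype.ext (Lp.ext h)

theorem rep_sum {ι : Type*} (s : Finset ι) (u : ι → L2star T) :
    rep (∑ i ∈ s, u i) =ᵐ[volume.restrict (Iio T)] fun t => ∑ i ∈ s, rep (u i) t := by
  classical
  induction s using Finset.induction_on with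
  | empty => exact Lp.coeFn_zero ℝ 2 (volume.restrict (Iio T))
  | insert a s ha ih =>
    rw [Finset.sum_insert ha]
    filter_upwards [rep_add (u a) (∑ i ∈ s, u i), ih] with t h1 h2
    rw [h1, h2, Finset.sum_insert ha]

/-- An essentially bounded measurable function that vanishes on `(-∞, 0)` is in `L²⋆(0, T)`. -/
theorem exists_rep_ae_eq {f : ℝ → ℝ} {C : ℝ}
    (hf : AEStronglyMeasurable f (volume.restrict (Iio T)))
    (hC : ∀ᵐ t ∂(volume.restrict (Iio T)), |f t| ≤ C)
    (h0 : ∀ᵐ t ∂(volume.restrict (Iio T)), t < 0 → f t = 0) :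
    ∃ u : L2star T, rep u =ᵐ[volume.restrict (Iio T)] f := by
  have hind : (Ici 0).indicator f =ᵐ[volume.restrict (Iio T)] f := by
    filter_upwards [h0] with t ht
    by_cases h : 0 ≤ t
    · simp [h]
    · simp [h, ht (not_le.1 h)]
  have hfin : IsFiniteMeasure ((volume.restrict (Iio T)).restrict (Ici (0:ℝ))) := by
    rw [Measure.restrict_restrict measurableSet_Ici, Ici_inter_Iio]
    infer_instance
  have hmem : MemLp f 2 (volume.restrict (Iio T)) := by
    refine MemLp.ae_eq hind ((memLp_indicator_iff_restrict measurableSet_Ici).2 ?_)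
    exact MemLp.of_bound hf.restrict C (ae_restrict_of_ae hC)
  refine ⟨⟨hmem.toLp f, ?_⟩, hmem.coeFn_toLp⟩
  show ∀ᵐ t ∂_, _
  filter_upwards [hmem.coeFn_toLp, h0] with t h1 h2 ht
  rw [h1, h2 ht]

theorem exists_rep_ae_eq_one (T : ℝ) :
    ∃ u : L2star T, rep u =ᵐ[volume.restrict (Iio T)] (Ici 0).indicator 1 := by
  refine exists_rep_ae_eq (C := 1) ?_ (.of_forall fun t => ?_) (.of_forall fun t ht => ?_)
  · exact (measurable_one.indicator measurableSet_Ici).aestronglyMeasurable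
  · by_cases h : 0 ≤ t <;> simp [h]
  · simp [ht]

/-- The function that is constant one on `(0, T)`. -/
def one (T : ℝ) : L2star T := (exists_rep_ae_eq_one T).choose

theorem rep_one (T : ℝ) : rep (one T) =ᵐ[volume.restrict (Iio T)] (Ici 0).indicator 1 :=
  (exists_rep_ae_eq_one T).choose_spec

theorem ae_restrict_Ioo_iff {p : ℝ → Prop} :
    (∀ᵐ t ∂(volume.restrict (Ioo 0 T)), p t) ↔
      ∀ᵐ t ∂(volume.restrict (Iio T)), 0 ≤ t → p t := by
  have h0 : ∀ᵐ t : ℝ, t ≠ 0 := by simp [ae_iff]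
  rw [ae_restrict_iff' measurableSet_Ioo, ae_restrict_iff' measurableSet_Iio]
  constructor <;> intro h <;> filter_upwards [h, h0] with t ht h0
  · exact fun h1 h2 => ht ⟨lt_of_le_of_ne h2 (Ne.symm h0), h1⟩
  · exact fun h1 => ht h1.2 h1.1.le

/-! ### Testing against derivatives -/

theorem integrable_rep_mul (u : L2star T) {g : ℝ → ℝ} (hg : Continuous g)
    (hc : HasCompactSupport g) :
    Integrable (fun t => rep u t * g t) (volume.restrict (Iio T)) :=
  (memLp_rep u).integrable_mul (q := 2) (hg.memLp_of_hasCompactSupport hc)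

theorem continuous_deriv_test (φ : 𝓓(domain T, ℝ)) : Continuous (deriv φ) :=
  φ.contDiff.continuous_deriv (by simp)

/-- The functional `u ↦ ∫ u φ'`. -/
def pairing (φ : 𝓓(domain T, ℝ)) : L2star T →L[ℝ] ℝ :=
  (innerSL ℝ ((((continuous_deriv_test φ).memLp_of_hasCompactSupport
    φ.hasCompactSupport.deriv : MemLp (deriv φ) 2 (volume.restrict (Iio T)))).toLp _)).comp
    (L2star T).subtypeL

theorem pairing_apply (φ : 𝓓(domain T, ℝ)) (u : L2star T) :
    pairing φ u = ∫ t in Iio T, rep u t * deriv φ t := by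
  show inner ℝ (MemLp.toLp _ _) (u : L2 T) = _
  rw [L2.inner_def]
  refine integral_congr_ae ?_
  filter_upwards [MemLp.coeFn_toLp ((continuous_deriv_test φ).memLp_of_hasCompactSupport
    φ.hasCompactSupport.deriv : MemLp (deriv φ) 2 (volume.restrict (Iio T)))] with t ht
  rw [ht]
  simp [rep]

theorem distribDeriv_eq (u : L2star T) (φ : 𝓓(domain T, ℝ)) :
    distribDeriv u φ = -pairing φ u := by
  rw [pairing_apply, distribDeriv]

theorem derivLE_iff {u v : L2star T} :
    DerivLE u v ↔ ∀ φ : 𝓓(domain T, ℝ), (∀ t, 0 ≤ φ t) → pairing φ v ≤ pairing φ u := by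
  simp only [DerivLE, distribDeriv_eq, neg_le_neg_iff]

theorem derivLE_zero_sub {u v : L2star T} : DerivLE 0 (v - u) ↔ DerivLE u v := by
  simp only [derivLE_iff, map_sub, map_zero, sub_nonpos]

theorem variation_le_iff {u : L2star T} {σ : ℕ} :
    variation u ≤ (σ : ℝ≥0∞) ↔
      ∀ φ : 𝓓(domain T, ℝ), (∀ t, |φ t| ≤ 1) → pairing φ u ≤ σ := by
  simp only [variation, iSup_le_iff, pairing_apply]
  refine forall_congr' fun φ => forall_congr' fun _ => ?_
  rw [← ENNReal.ofReal_natCast, ENNReal.ofReal_le_ofReal_iff (Nat.cast_nonneg σ)]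

/-! ### Smoothed jumps -/

/-- A smooth monotone function that is zero on `(-∞, a]` and one on `[a + δ, ∞)`. -/
def smoothStep (a δ t : ℝ) : ℝ := Real.smoothTransition ((t - a) / δ)

theorem contDiff_smoothStep (a δ : ℝ) : ContDiff ℝ (⊤ : ℕ∞) (smoothStep a δ) := by
  have : ContDiff ℝ (⊤ : ℕ∞) fun t : ℝ => (t - a) / δ := by fun_prop
  exact Real.smoothTransition.contDiff.comp this

theorem smoothStep_nonneg (a δ t : ℝ) : 0 ≤ smoothStep a δ t := Real.smoothTransition.nonneg _

theorem smoothStep_le_one (a δ t : ℝ) : smoothStep a δ t ≤ 1 := Real.smoothTransition.le_one _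

theorem smoothStep_of_le {a δ t : ℝ} (hδ : 0 < δ) (h : t ≤ a) : smoothStep a δ t = 0 :=
  Real.smoothTransition.zero_of_nonpos (div_nonpos_of_nonpos_of_nonneg (by linarith) hδ.le)

theorem smoothStep_of_ge {a δ t : ℝ} (hδ : 0 < δ) (h : a + δ ≤ t) : smoothStep a δ t = 1 :=
  Real.smoothTransition.one_of_one_le ((one_le_div hδ).2 (by linarith))

theorem smoothStep_anti {a b δ : ℝ} (hδ : 0 < δ) (h : a ≤ b) (t : ℝ) :
    smoothStep b δ t ≤ smoothStep a δ t :=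
  Real.smoothTransition.monotone (by gcongr)

theorem continuous_deriv_smoothStep (a δ : ℝ) : Continuous (deriv (smoothStep a δ)) :=
  (contDiff_smoothStep a δ).continuous_deriv (by simp)

theorem deriv_eq_zero_of_notMem_Icc {f : ℝ → ℝ} {a b c d : ℝ} (ha : ∀ t ≤ a, f t = c)
    (hb : ∀ t, b ≤ t → f t = d) {t : ℝ} (ht : t ∉ Icc a b) : deriv f t = 0 := by
  rw [mem_Icc, not_and_or, not_le, not_le] at ht
  rcases ht with ht | ht
  · have : f =ᶠ[𝓝 t] fun _ => c := by
      filter_upwards [Iio_mem_nhds ht] with s hs using ha s hs.le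
    rw [this.deriv_eq, deriv_const]
  · have : f =ᶠ[𝓝 t] fun _ => d := by
      filter_upwards [Ioi_mem_nhds ht] with s hs using hb s hs.le
    rw [this.deriv_eq, deriv_const]

theorem hasCompactSupport_deriv {f : ℝ → ℝ} {a b c d : ℝ} (ha : ∀ t ≤ a, f t = c)
    (hb : ∀ t, b ≤ t → f t = d) : HasCompactSupport (deriv f) :=
  HasCompactSupport.intro isCompact_Icc fun _ => deriv_eq_zero_of_notMem_Icc ha hb

theorem hasCompactSupport_deriv_smoothStep (a : ℝ) {δ : ℝ} (hδ : 0 < δ) :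
    HasCompactSupport (deriv (smoothStep a δ)) :=
  hasCompactSupport_deriv (fun _ h => smoothStep_of_le hδ h) fun _ h => smoothStep_of_ge hδ h

theorem integral_deriv_smoothStep (a : ℝ) {δ : ℝ} (hδ : 0 < δ) :
    ∫ t, deriv (smoothStep a δ) t = 1 := by
  have := integral_of_hasDerivAt_of_tendsto (f := smoothStep a δ) (m := 0) (n := 1)
    (fun t => ((contDiff_smoothStep a δ).differentiable (by simp) t).hasDerivAt)
    ((continuous_deriv_smoothStep a δ).integrable_of_hasCompactSupport
      (hasCompactSupport_deriv_smoothStep a hδ))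
    (tendsto_const_nhds.congr' ?_) (tendsto_const_nhds.congr' ?_)
  · simpa using this
  · filter_upwards [eventually_le_atBot a] with t ht using (smoothStep_of_le hδ ht).symm
  · filter_upwards [eventually_ge_atTop (a + δ)] with t ht using (smoothStep_of_ge hδ ht).symm

/-- All smooth steps are translates and rescalings of one profile. The bound by `C / δ` makes them
kernels that are dominated by averages over balls of radius `δ`. -/
theorem exists_abs_deriv_smoothStep_le :
    ∃ C : ℝ, 0 ≤ C ∧ ∀ a δ t : ℝ, 0 < δ → |deriv (smoothStep a δ) t| ≤ C / δ := by
  obtain ⟨C, hC⟩ := (continuous_deriv_smoothStep 0 1).bounded_above_of_compact_support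
    (hasCompactSupport_deriv_smoothStep 0 one_pos)
  refine ⟨C, (norm_nonneg _).trans (hC 0), fun a δ t hδ => ?_⟩
  have h1 : smoothStep a δ = fun t => smoothStep 0 1 ((t - a) / δ) := by
    funext t; simp [smoothStep]
  have h2 : HasDerivAt (smoothStep a δ) (deriv (smoothStep 0 1) ((t - a) / δ) * (1 / δ)) t := by
    rw [h1]
    refine HasDerivAt.comp t (h₂ := smoothStep 0 1)
      ((contDiff_smoothStep 0 1).differentiable (by simp) _).hasDerivAt ?_
    exact ((hasDerivAt_id t).sub_const a).div_const δ
  rw [h2.deriv, abs_mul, abs_of_pos (one_div_pos.2 hδ), mul_one_div]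
  exact div_le_div_of_nonneg_right (hC _) hδ.le

/-- At almost every point, testing with smoothed jumps recovers the value of a locally integrable
function. -/
theorem ae_tendsto_integral_mul_deriv_smoothStep {f : ℝ → ℝ} (hf : LocallyIntegrable f) :
    ∀ᵐ a, Tendsto (fun δ => ∫ t, f t * deriv (smoothStep a δ) t) (𝓝[>] 0) (𝓝 (f a)) := by
  obtain ⟨C, hC0, hC⟩ := exists_abs_deriv_smoothStep_le
  filter_upwards [IsUnifLocDoublingMeasure.ae_tendsto_average_norm_sub volume hf 1] with a ha
  have key := ha (fun _ : ℝ => a) id tendsto_id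
    (by filter_upwards [self_mem_nhdsWithin] with δ hδ using by simpa using le_of_lt hδ)
  -- The kernel is at most `C / δ` and the ball has length `2δ`; hence the factor `2C` in front of
  -- the average that tends to zero by Lebesgue differentiation.
  have key2 := key.const_mul (2 * C)
  rw [mul_zero] at key2
  rw [tendsto_iff_norm_sub_tendsto_zero]
  refine squeeze_zero' (.of_forall fun _ => norm_nonneg _) ?_ key2
  filter_upwards [self_mem_nhdsWithin] with δ (hδ : 0 < δ)
  have hcont := continuous_deriv_smoothStep a δ
  have hsupp := hasCompactSupport_deriv_smoothStep a hδ
  have hi1 : Integrable fun t => f t * deriv (smoothStep a δ) t := by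
    simpa [mul_comm] using hf.integrable_smul_left_of_hasCompactSupport hcont hsupp
  have hi2 : Integrable fun t => f a * deriv (smoothStep a δ) t :=
    (hcont.integrable_of_hasCompactSupport hsupp).const_mul _
  have e1 : (∫ t, f t * deriv (smoothStep a δ) t) - f a =
      ∫ t in Metric.closedBall a δ, (f t - f a) * deriv (smoothStep a δ) t := by
    rw [setIntegral_eq_integral_of_forall_compl_eq_zero]
    · simp only [sub_mul]
      rw [integral_sub hi1 hi2, integral_const_mul, integral_deriv_smoothStep a hδ, mul_one]
    · intro t ht
      rw [deriv_eq_zero_of_notMem_Icc (fun _ h => smoothStep_of_le hδ h)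
        (fun _ h => smoothStep_of_ge hδ h) (t := t), mul_zero]
      rw [Real.closedBall_eq_Icc] at ht
      exact fun h => ht ⟨by linarith [h.1], h.2⟩
  have hloc : IntegrableOn (fun t => ‖f t - f a‖) (Metric.closedBall a δ) :=
    ((hf.integrableOn_isCompact (isCompact_closedBall a δ)).sub
      (integrableOn_const measure_closedBall_lt_top.ne)).norm
  rw [e1]
  calc ‖∫ t in Metric.closedBall a δ, (f t - f a) * deriv (smoothStep a δ) t‖
      ≤ ∫ t in Metric.closedBall a δ, ‖f t - f a‖ * (C / δ) := by
        refine norm_integral_le_of_norm_le (hloc.mul_const _) (.of_forall fun t => ?_)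
        rw [norm_mul]
        exact mul_le_mul_of_nonneg_left (hC a δ t hδ) (norm_nonneg _)
    _ = 2 * C * ⨍ y in Metric.closedBall (a : ℝ) (id δ), ‖f y - f a‖ := by
        rw [integral_mul_const, setAverage_eq, Measure.real, Real.volume_closedBall,
          ENNReal.toReal_ofReal (by simpa using hδ.le), smul_eq_mul, id]
        field_simp

/-- The points at which smoothed jumps recover the value of `u`. -/
def regularPoints (u : L2star T) : Set ℝ :=
  {a | a < T ∧ Tendsto (fun δ => ∫ t in Iio T, rep u t * deriv (smoothStep a δ) t) (𝓝[>] 0)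
    (𝓝 (rep u a))}

theorem ae_mem_regularPoints (u : L2star T) :
    ∀ᵐ a ∂(volume.restrict (Iio T)), a ∈ regularPoints u := by
  have h1 : MemLp ((Iio T).indicator (rep u)) 2 volume :=
    (memLp_indicator_iff_restrict measurableSet_Iio).2 (memLp_rep u)
  have h2 : LocallyIntegrable ((Iio T).indicator (rep u)) volume :=
    h1.locallyIntegrable (by norm_num)
  rw [ae_restrict_iff' measurableSet_Iio]
  filter_upwards [ae_tendsto_integral_mul_deriv_smoothStep h2] with a ha haT
  refine ⟨haT, ?_⟩
  rw [indicator_of_mem haT] at ha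
  refine ha.congr fun δ => ?_
  rw [← integral_indicator measurableSet_Iio]
  congr 1
  funext t
  by_cases ht : t ∈ Iio T <;> simp [ht]

/-- A smooth function that vanishes outside a compact interval in `(-∞, T)`, as a test
function. -/
def testOfIcc {f : ℝ → ℝ} {a b : ℝ} (hf : ContDiff ℝ (⊤ : ℕ∞) f) (hb : b < T)
    (ha : ∀ t ≤ a, f t = 0) (hfb : ∀ t, b ≤ t → f t = 0) : 𝓓(domain T, ℝ) where
  toFun := f
  contDiff' := hf
  hasCompactSupport' := HasCompactSupport.intro (K := Icc a b) isCompact_Icc fun t ht => by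
    rw [mem_Icc, not_and_or, not_le, not_le] at ht
    exact ht.elim (fun h => ha t h.le) fun h => hfb t h.le
  tsupport_subset' := by
    have h : tsupport f ⊆ Icc a b := closure_minimal (fun t ht => by
      by_contra h
      rw [mem_Icc, not_and_or, not_le, not_le] at h
      exact ht (h.elim (fun h => ha t h.le) fun h => hfb t h.le)) isClosed_Icc
    exact fun t ht => (h ht).2.trans_lt hb

/-- A function with non-negative derivative is monotone on the regular points. -/
theorem rep_le_rep_of_derivLE {w : L2star T} (hw : DerivLE 0 w) {a b : ℝ}
    (ha : a ∈ regularPoints w) (hb : b ∈ regularPoints w) (hab : a ≤ b) : rep w a ≤ rep w b := by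
  refine le_of_tendsto_of_tendsto ha.2 hb.2 ?_
  filter_upwards [self_mem_nhdsWithin, Ioo_mem_nhdsGT (sub_pos.2 hb.1)] with δ (hδ : 0 < δ) hδ2
  have hb2 : b + δ < T := by linarith [hδ2.2]
  -- A step at `a` minus a later step at `b` is a non-negative bump with compact support, and
  -- pairing `w` with it tends to `rep w a - rep w b`.
  let φ : 𝓓(domain T, ℝ) := testOfIcc (f := fun t => smoothStep a δ t - smoothStep b δ t) (a := a)
    (b := b + δ) ((contDiff_smoothStep a δ).sub (contDiff_smoothStep b δ)) hb2
    (fun t ht => by rw [smoothStep_of_le hδ ht, smoothStep_of_le hδ (ht.trans hab), sub_zero])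
    (fun t ht => by rw [smoothStep_of_ge hδ ht, smoothStep_of_ge hδ (by linarith), sub_self])
  have h := derivLE_iff.1 hw φ (fun t => sub_nonneg.2 (smoothStep_anti hδ hab t))
  rw [map_zero, pairing_apply] at h
  have hφ : ∀ t, deriv φ t = deriv (smoothStep a δ) t - deriv (smoothStep b δ) t := fun t =>
    deriv_sub ((contDiff_smoothStep a δ).differentiable (by simp) t)
      ((contDiff_smoothStep b δ).differentiable (by simp) t)
  simp only [hφ, mul_sub] at h
  rw [integral_sub (integrable_rep_mul w (continuous_deriv_smoothStep a δ)
      (hasCompactSupport_deriv_smoothStep a hδ))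
    (integrable_rep_mul w (continuous_deriv_smoothStep b δ)
      (hasCompactSupport_deriv_smoothStep b hδ))] at h
  linarith

/-! ### Monotone integer-valued functions -/

theorem integral_deriv_test_Ioi (φ : 𝓓(domain T, ℝ)) (a : ℝ) (ha : a ≤ T) :
    ∫ t in Iio T, (Ioi a).indicator 1 t * deriv φ t = -φ a := by
  have hT : φ T = 0 := by
    by_contra h
    exact lt_irrefl T (φ.tsupport_subset (subset_tsupport _ h) : T < T)
  have h1 : ∀ t, (Ioi a).indicator (1 : ℝ → ℝ) t * deriv φ t = (Ioi a).indicator (deriv φ) t := by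
    intro t
    by_cases h : t ∈ Ioi a <;> simp [h]
  simp only [h1]
  rw [setIntegral_indicator measurableSet_Ioi, inter_comm, Ioi_inter_Iio,
    ← integral_Ioc_eq_integral_Ioo, ← intervalIntegral.integral_of_le ha,
    intervalIntegral.integral_deriv_eq_sub
      (fun t _ => φ.contDiff.differentiable (by simp) t)
      ((continuous_deriv_test φ).intervalIntegrable _ _), hT, zero_sub]

/-- The derivative of a bounded monotone function with values in `ℕ` is a sum of point
masses. -/
theorem exists_integral_mul_deriv_eq {f : ℝ → ℕ} {G : Set ℝ} {m : ℕ}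
    (hG : ∀ᵐ t ∂(volume.restrict (Iio T)), t ∈ G) (hGT : G ⊆ Iio T) (hmono : MonotoneOn f G)
    (hm : ∀ t ∈ G, f t ≤ m) (h0 : ∀ t ∈ G, t < 0 → f t = 0) :
    ∃ a : Fin m → ℝ, ∀ φ : 𝓓(domain T, ℝ),
      ∫ t in Iio T, (f t : ℝ) * deriv φ t = -∑ k, φ (a k) := by
  -- Layer cake: `f` is the sum over `k < m` of the indicators of `{k < f}`. By monotonicity each of
  -- these sets is, up to a null set, a half-line starting at its infimum.
  have hlevel : ∀ k : Fin m, ∃ a ≤ T, ∀ᵐ t ∂(volume.restrict (Iio T)),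
      (if (k : ℕ) < f t then (1 : ℝ) else 0) = (Ioi a).indicator 1 t := by
    intro k
    set A := {t ∈ G | (k : ℕ) < f t} with hA
    rcases A.eq_empty_or_nonempty with hE | hne
    -- An empty level set gets the point mass at `T`, where all test functions vanish.
    · refine ⟨T, le_rfl, ?_⟩
      filter_upwards [hG] with t ht
      have h1 : ¬ (k : ℕ) < f t := fun h => (hE ▸ (⟨ht, h⟩ : t ∈ A) : t ∈ (∅ : Set ℝ))
      have h2 : t ∉ Ioi T := fun h => lt_asymm (mem_Iio.1 (hGT ht)) (mem_Ioi.1 h)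
      rw [if_neg h1, indicator_of_notMem h2]
    · have hbdd : BddBelow A := ⟨0, fun t ht => by
        by_contra h
        have := h0 t ht.1 (not_le.1 h)
        have := ht.2
        omega⟩
      obtain ⟨s₀, hs₀⟩ := hne
      refine ⟨sInf A, (csInf_le hbdd hs₀).trans (le_of_lt (hGT hs₀.1)), ?_⟩
      have hne0 : ∀ᵐ t ∂(volume.restrict (Iio T)), t ≠ sInf A :=
        ae_restrict_of_ae (by simp [ae_iff])
      filter_upwards [hG, hne0] with t ht hta
      by_cases h : sInf A < t
      · obtain ⟨s, hs, hst⟩ := exists_lt_of_csInf_lt ⟨s₀, hs₀⟩ h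
        rw [if_pos (hs.2.trans_le (hmono hs.1 ht hst.le)), indicator_of_mem (show t ∈ Ioi _ from h)]
        rfl
      · rw [if_neg, indicator_of_notMem (show t ∉ Ioi _ from h)]
        intro h2
        exact h (lt_of_le_of_ne (csInf_le hbdd ⟨ht, h2⟩) (Ne.symm hta))
  choose a haT ha using hlevel
  refine ⟨a, fun φ => ?_⟩
  have e1 : ∀ᵐ t ∂(volume.restrict (Iio T)),
      (f t : ℝ) * deriv φ t = ∑ k, (Ioi (a k)).indicator 1 t * deriv φ t := by
    filter_upwards [hG, ae_all_iff.2 ha] with t ht hat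
    rw [← Finset.sum_mul]
    congr 1
    simp only [← hat]
    rw [Finset.sum_boole, Fin.card_filter_val_lt, min_eq_right (hm t ht)]
  rw [integral_congr_ae e1, integral_finsetSum, ← Finset.sum_neg_distrib]
  · exact Finset.sum_congr rfl fun k _ => integral_deriv_test_Ioi φ (a k) (haT k)
  · intro k _
    refine Integrable.bdd_mul (c := 1) ?_ ?_ ?_
    · exact ((continuous_deriv_test φ).integrable_of_hasCompactSupport
        φ.hasCompactSupport.deriv).restrict
    · exact (measurable_one.indicator measurableSet_Ioi).aestronglyMeasurable
    · refine .of_forall fun t => ?_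
      by_cases h : t ∈ Ioi (a k) <;> simp [h]

/-! ### Averages of shifted integer parts -/

/-- Hermite's identity for integers: replacing `n` by `n + 1` shifts the summation window, which
trades the term `n / M` for `(n + M) / M = n / M + 1`. -/
theorem sum_range_add_div (n : ℕ) {M : ℕ} (hM : 0 < M) :
    ∑ j ∈ Finset.range M, (n + j) / M = n := by
  induction n with
  | zero =>
    refine Finset.sum_eq_zero fun j hj => ?_
    rw [zero_add, Nat.div_eq_of_lt (Finset.mem_range.1 hj)]
  | succ n ih =>
    have h1 := Finset.sum_range_succ (fun j => (n + j) / M) M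
    have h2 := Finset.sum_range_succ' (fun j => (n + j) / M) M
    have h3 : (n + M) / M = n / M + 1 := Nat.add_div_right n hM
    have h4 : ∑ j ∈ Finset.range M, (n + 1 + j) / M = ∑ j ∈ Finset.range M, (n + (j + 1)) / M :=
      Finset.sum_congr rfl fun j _ => by rw [add_assoc, add_comm 1 j]
    rw [h4]
    simp only [add_zero] at h2
    omega

/-- Hermite's identity for reals. It reduces to the integer `⌊M * x⌋₊`, because the floor of a
quotient by `M` depends only on the floor of the numerator. -/
theorem sum_floor_add_div {x : ℝ} (hx : 0 ≤ x) {M : ℕ} (hM : 0 < M) :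
    ∑ j ∈ Finset.range M, ⌊x + j / M⌋₊ = ⌊M * x⌋₊ := by
  have hM' : (0 : ℝ) < M := by exact_mod_cast hM
  rw [← sum_range_add_div ⌊M * x⌋₊ hM]
  refine Finset.sum_congr rfl fun j _ => ?_
  have h1 : x + j / M = (M * x + j) / M := by field_simp
  rw [h1, Nat.floor_div_natCast, Nat.floor_add_natCast (by positivity)]

/-- By Hermite's identity both averages err downwards by less than `1/M`, so the errors partly
cancel in the difference and do not add up. -/
theorem abs_average_floor_sub_le {x y : ℝ} (hx : 0 ≤ x) (hy : 0 ≤ y) {M : ℕ} (hM : 0 < M) :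
    |∑ j ∈ Finset.range M, (M : ℝ)⁻¹ * ((⌊x + j / M⌋₊ : ℝ) - ⌊y + j / M⌋₊) - (x - y)| ≤
      (M : ℝ)⁻¹ := by
  have hM' : (0 : ℝ) < M := by exact_mod_cast hM
  rw [← Finset.mul_sum, Finset.sum_sub_distrib, ← Nat.cast_sum, ← Nat.cast_sum,
    sum_floor_add_div hx hM, sum_floor_add_div hy hM]
  have h1 := Nat.floor_le (show 0 ≤ M * x by positivity)
  have h2 := Nat.lt_floor_add_one (M * x)
  have h3 := Nat.floor_le (show 0 ≤ M * y by positivity)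
  have h4 := Nat.lt_floor_add_one (M * y)
  have h5 : (M : ℝ)⁻¹ * ((⌊M * x⌋₊ : ℝ) - ⌊M * y⌋₊) - (x - y) =
      (M : ℝ)⁻¹ * ((⌊M * x⌋₊ - M * x) - (⌊M * y⌋₊ - M * y)) := by field_simp; ring
  rw [h5, abs_mul, abs_of_pos (inv_pos.2 hM')]
  refine mul_le_of_le_one_right (inv_pos.2 hM').le (abs_le.2 ⟨by linarith, by linarith⟩)

/-! ### Differences of monotone functions -/

/-- The difference of two bounded monotone functions with values in `ℕ` has bounded
variation. -/
theorem variation_le_of_sub {f g : ℝ → ℕ} {G : Set ℝ} {m : ℕ}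
    (hG : ∀ᵐ t ∂(volume.restrict (Iio T)), t ∈ G) (hGT : G ⊆ Iio T)
    (hf : MonotoneOn f G) (hfm : ∀ t ∈ G, f t ≤ m) (hf0 : ∀ t ∈ G, t < 0 → f t = 0)
    (hg : MonotoneOn g G) (hgm : ∀ t ∈ G, g t ≤ m) (hg0 : ∀ t ∈ G, t < 0 → g t = 0)
    (hfs : AEStronglyMeasurable (fun t => (f t : ℝ)) (volume.restrict (Iio T)))
    (hgs : AEStronglyMeasurable (fun t => (g t : ℝ)) (volume.restrict (Iio T)))
    {u : L2star T} (hu : rep u =ᵐ[volume.restrict (Iio T)] fun t => (f t : ℝ) - g t) :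
    variation u ≤ ((2 * m : ℕ) : ℝ≥0∞) := by
  -- The derivative of `u` consists of `m` positive and `m` negative unit point masses, and each
  -- contributes at most `1` when tested with `|φ| ≤ 1`.
  obtain ⟨a, ha⟩ := exists_integral_mul_deriv_eq hG hGT hf hfm hf0
  obtain ⟨b, hb⟩ := exists_integral_mul_deriv_eq hG hGT hg hgm hg0
  have hmul : ∀ (h : ℝ → ℕ), (∀ t ∈ G, h t ≤ m) →
      AEStronglyMeasurable (fun t => (h t : ℝ)) (volume.restrict (Iio T)) →
      ∀ φ : 𝓓(domain T, ℝ),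
        Integrable (fun t => (h t : ℝ) * deriv φ t) (volume.restrict (Iio T)) := by
    intro h hm hs φ
    refine Integrable.bdd_mul (c := m) ?_ hs ?_
    · exact ((continuous_deriv_test φ).integrable_of_hasCompactSupport
        φ.hasCompactSupport.deriv).restrict
    · filter_upwards [hG] with t ht
      simpa using hm t ht
  rw [variation_le_iff]
  intro φ hφ
  have e : ∀ᵐ t ∂(volume.restrict (Iio T)),
      rep u t * deriv φ t = (f t : ℝ) * deriv φ t - g t * deriv φ t := by
    filter_upwards [hu] with t ht
    rw [ht, sub_mul]
  rw [pairing_apply, integral_congr_ae e, integral_sub (hmul f hfm hfs φ) (hmul g hgm hgs φ),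
    ha, hb]
  have h1 : -∑ k, φ (a k) ≤ m := by
    rw [← Finset.sum_neg_distrib]
    refine (Finset.sum_le_card_nsmul _ _ 1 fun k _ => ?_).trans (by simp)
    linarith [(abs_le.1 (hφ (a k))).1]
  have h2 : ∑ k, φ (b k) ≤ m := by
    refine (Finset.sum_le_card_nsmul _ _ 1 fun k _ => ?_).trans (by simp)
    exact (abs_le.1 (hφ (b k))).2
  push_cast
  linarith

/-! ### Step functions -/

theorem cell_subset {N : ℕ} (hT : 0 < T) (i : Fin N) :
    Ioo ((i : ℝ) * (T / N)) (((i : ℝ) + 1) * (T / N)) ⊆ Iio T := fun t ht => by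
  have hN : (0 : ℝ) < N := by exact_mod_cast i.pos
  have h1 : ((i : ℕ) : ℝ) + 1 ≤ N := by exact_mod_cast i.2
  have h2 : ((i : ℝ) + 1) * (T / N) ≤ N * (T / N) := by gcongr
  have h3 : (N : ℝ) * (T / N) = T := by field_simp
  exact lt_of_lt_of_le ht.2 (by linarith)

theorem ae_cell_of_ae {N : ℕ} (hT : 0 < T) (i : Fin N) {p : ℝ → Prop}
    (h : ∀ᵐ t ∂(volume.restrict (Iio T)), p t) :
    ∀ᵐ t ∂(volume.restrict (Ioo ((i : ℝ) * (T / N)) (((i : ℝ) + 1) * (T / N)))), p t :=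
  ae_mono (Measure.restrict_mono_set volume (cell_subset hT i)) h

/-- Almost every point of `(0, T)` is in a cell. -/
theorem ae_of_ae_cell {N : ℕ} (hT : 0 < T) (hN : 0 < N) {p : ℝ → Prop}
    (h : ∀ i : Fin N,
      ∀ᵐ t ∂(volume.restrict (Ioo ((i : ℝ) * (T / N)) (((i : ℝ) + 1) * (T / N)))), p t) :
    ∀ᵐ t ∂(volume.restrict (Ioo 0 T)), p t := by
  have hN' : (0 : ℝ) < N := by exact_mod_cast hN
  have hTN : 0 < T / N := by positivity
  have h1 : ∀ᵐ t : ℝ, t ∉ range fun k : ℕ => (k : ℝ) * (T / N) :=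
    (measure_eq_zero_iff_ae_notMem).1 ((countable_range _).measure_zero _)
  simp only [ae_restrict_iff' measurableSet_Ioo] at h ⊢
  filter_upwards [ae_all_iff.2 h, h1] with t ht hk h0
  set k := ⌊t / (T / N)⌋₊ with hkdef
  have hk1 : (k : ℝ) ≤ t / (T / N) := Nat.floor_le (div_nonneg h0.1.le hTN.le)
  have hk2 : t / (T / N) < k + 1 := Nat.lt_floor_add_one _
  rw [le_div_iff₀ hTN] at hk1
  rw [div_lt_iff₀ hTN] at hk2
  have hkN : k < N := by
    have : (k : ℝ) < N := by
      by_contra hc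
      have h2 : (N : ℝ) * (T / N) ≤ k * (T / N) :=
        mul_le_mul_of_nonneg_right (not_lt.1 hc) hTN.le
      have h3 : (N : ℝ) * (T / N) = T := by field_simp
      linarith [h0.2]
    exact_mod_cast this
  exact ht ⟨k, hkN⟩ ⟨lt_of_le_of_ne hk1 fun e => hk ⟨k, e⟩, hk2⟩

theorem IsStep.unique {N : ℕ} (hT : 0 < T) (hN : 0 < N) {v : Fin N → ℝ} {u u' : L2star T}
    (h : IsStep N v u) (h' : IsStep N v u') : u = u' := by
  have h1 : ∀ᵐ t ∂(volume.restrict (Ioo 0 T)), rep u t = rep u' t :=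
    ae_of_ae_cell hT hN fun i => by
      filter_upwards [h i, h' i] with t h1 h2
      rw [h1, h2]
  refine rep_ext ?_
  filter_upwards [ae_restrict_Ioo_iff.1 h1, rep_eq_zero_of_neg u, rep_eq_zero_of_neg u']
    with t h1 h2 h3
  rcases le_or_gt 0 t with h | h
  · exact h1 h
  · rw [h2 h, h3 h]

theorem IsStep.add {N : ℕ} (hT : 0 < T) {v w : Fin N → ℝ} {x y : L2star T} (hx : IsStep N v x)
    (hy : IsStep N w y) : IsStep N (fun i => v i + w i) (x + y) := fun i => by
  filter_upwards [hx i, hy i, ae_cell_of_ae hT i (rep_add x y)] with t h1 h2 h3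
  rw [h3, h1, h2]

theorem IsStep.smul {N : ℕ} (hT : 0 < T) (c : ℝ) {v : Fin N → ℝ} {x : L2star T}
    (hx : IsStep N v x) : IsStep N (fun i => c * v i) (c • x) := fun i => by
  filter_upwards [hx i, ae_cell_of_ae hT i (rep_smul c x)] with t h1 h3
  rw [h3, h1]

theorem isStep_one {N : ℕ} (hT : 0 < T) : IsStep N (fun _ => 1) (one T) := fun i => by
  filter_upwards [ae_cell_of_ae hT i (rep_one T), ae_restrict_mem measurableSet_Ioo] with t h1 h2
  have : 0 ≤ (i : ℝ) * (T / N) := by positivity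
  rw [h1, indicator_of_mem (show t ∈ Ici 0 from this.trans h2.1.le), Pi.one_apply]

theorem cell_neZero {N : ℕ} (hT : 0 < T) (i : Fin N) :
    (ae (volume.restrict (Ioo ((i : ℝ) * (T / N)) (((i : ℝ) + 1) * (T / N))))).NeBot := by
  have hN : (0 : ℝ) < N := by exact_mod_cast i.pos
  have hTN : 0 < T / N := by positivity
  rw [ae_neBot, Ne, Measure.restrict_eq_zero, Real.volume_Ioo, ENNReal.ofReal_eq_zero, not_le]
  linarith

/-- A switch on the grid is determined by its `N` binary values. Finiteness makes the convex hull
compact, hence closed. -/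
theorem discretize_switches_finite {N : ℕ} (hT : 0 < T) (hN : 0 < N) (σ : ℕ) :
    (discretize (switches T σ) N).Finite := by
  have hfin : {v : Fin N → ℝ | ∀ i, v i ∈ ({0, 1} : Set ℝ)}.Finite :=
    (Set.Finite.pi' fun _ => (Set.toFinite ({0, 1} : Set ℝ)))
  refine (hfin.image fun v => (exists_isStep hT hN v).choose).subset ?_
  rintro u ⟨⟨⟨hu, -⟩, -⟩, v, hv⟩
  refine ⟨v, fun i => ?_, (exists_isStep hT hN v).choose_spec.unique hT hN hv⟩
  have h1 := ae_cell_of_ae hT i (ae_restrict_Ioo_iff.1 hu)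
  have := cell_neZero hT i
  obtain ⟨t, h2, h3, h4⟩ := (h1.and ((hv i).and (ae_restrict_mem measurableSet_Ioo))).exists
  have : 0 ≤ (i : ℝ) * (T / N) := by positivity
  rw [← h3]
  exact h2 (this.trans h4.1.le)

/-! ### Rounding -/

theorem exists_neg_mem {G : Set ℝ} (hT : 0 < T) (hG : ∀ᵐ t ∂(volume.restrict (Iio T)), t ∈ G) :
    ∃ t ∈ G, t < 0 := by
  have h1 : ∀ᵐ t ∂(volume.restrict (Iio (0 : ℝ))), t ∈ G :=
    ae_mono (Measure.restrict_mono_set volume (Iio_subset_Iio hT.le)) hG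
  have : (ae (volume.restrict (Iio (0 : ℝ)))).NeBot := by
    rw [ae_neBot, Ne, Measure.restrict_eq_zero, Real.volume_Iio]
    simp
  exact (h1.and (ae_restrict_mem measurableSet_Iio)).exists

theorem floor_add_sub_floor_add_mem {a b c : ℝ} (hb : 0 ≤ b) (hc : 0 ≤ c) (h1 : b ≤ a)
    (h2 : a ≤ b + 1) : ((⌊a + c⌋₊ : ℝ) - ⌊b + c⌋₊) ∈ ({0, 1} : Set ℝ) := by
  have h3 : ⌊b + c⌋₊ ≤ ⌊a + c⌋₊ := Nat.floor_mono (by linarith)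
  have h4 : ⌊a + c⌋₊ ≤ ⌊b + c⌋₊ + 1 := by
    rw [← Nat.floor_add_one (by positivity)]
    exact Nat.floor_mono (by linarith)
  obtain h | h : ⌊a + c⌋₊ = ⌊b + c⌋₊ ∨ ⌊a + c⌋₊ = ⌊b + c⌋₊ + 1 := by omega
  · left; rw [h, sub_self]
  · right; rw [h, mem_singleton_iff]; push_cast; ring

theorem aestronglyMeasurable_floor_rep (w : L2star T) (c : ℝ) :
    AEStronglyMeasurable (fun t => (⌊rep w t + c⌋₊ : ℝ)) (volume.restrict (Iio T)) := by
  have h1 : Measurable fun x : ℝ => (⌊x + c⌋₊ : ℝ) := by fun_prop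
  exact (h1.comp_aemeasurable (memLp_rep w).aestronglyMeasurable.aemeasurable).aestronglyMeasurable

/-- A pair in the extended formulation is approximated by averages of switches, which are
piecewise constant on every grid on which the pair is. -/
theorem exists_convexHull_near {m : ℕ} (hT : 0 < T) {x : Fin (1 + 1) → L2star T}
    (hx : x ∈ switchesExt T (2 * m)) {M : ℕ} (hM : 0 < M) :
    ∃ y ∈ convexHull ℝ {u | u ∈ switches T (2 * m) ∧
        ∀ N : ℕ, (∀ c, x c ∈ stepFunctions T N) → u ∈ stepFunctions T N},
      ‖x 0 - y‖ ≤ (M : ℝ)⁻¹ * ‖one T‖ := by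
  obtain ⟨hu, hz, hzu, hz0⟩ := hx
  set u := x 0 with hu_def
  set z := x 1 with hz_def
  set w := z - u with hw_def
  have hM' : (0 : ℝ) < M := by exact_mod_cast hM
  have hw0 : DerivLE 0 w := derivLE_zero_sub.2 hzu
  set G : Set ℝ := {t | t ∈ regularPoints z ∧ t ∈ regularPoints w ∧
    rep w t = rep z t - rep u t ∧ (t < 0 → rep z t = 0 ∧ rep u t = 0) ∧
    0 ≤ rep u t ∧ rep u t ≤ 1 ∧ 0 ≤ rep z t ∧ rep z t ≤ m} with hG_def
  have hG : ∀ᵐ t ∂(volume.restrict (Iio T)), t ∈ G := by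
    filter_upwards [ae_mem_regularPoints z, ae_mem_regularPoints w, rep_sub z u,
      rep_eq_zero_of_neg z, rep_eq_zero_of_neg u, ae_restrict_Ioo_iff.1 hu,
      ae_restrict_Ioo_iff.1 hz] with t h1 h2 h3 h4 h5 h6 h7
    refine ⟨h1, h2, h3, fun h => ⟨h4 h, h5 h⟩, ?_⟩
    rcases le_or_gt 0 t with h | h
    · obtain ⟨h8, h9⟩ := h7 h
      exact ⟨(h6 h).1, (h6 h).2, h8, by push_cast at h9; linarith⟩
    · simp [h4 h, h5 h]
  have hGT : G ⊆ Iio T := fun t ht => ht.1.1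
  have hzG : MonotoneOn (rep z) G := fun a ha b hb hab =>
    rep_le_rep_of_derivLE hz0 ha.1 hb.1 hab
  have hwG : MonotoneOn (rep w) G := fun a ha b hb hab =>
    rep_le_rep_of_derivLE hw0 ha.2.1 hb.2.1 hab
  have hwneg : ∀ t ∈ G, t < 0 → rep w t = 0 := fun t ht h => by
    rw [ht.2.2.1, (ht.2.2.2.1 h).1, (ht.2.2.2.1 h).2, sub_zero]
  -- No constraint says `u ≤ z` directly: it follows because `z - u` is monotone and vanishes on the
  -- negative axis.
  have hwnn : ∀ t ∈ G, 0 ≤ rep w t := by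
    obtain ⟨s, hs, hs0⟩ := exists_neg_mem hT hG
    intro t ht
    rcases le_or_gt 0 t with h | h
    · rw [← hwneg s hs hs0]
      exact hwG hs ht (hs0.le.trans h)
    · exact (hwneg t ht h).ge
  have hfrac : ∀ j ∈ Finset.range M, (0 : ℝ) ≤ j / M ∧ (j : ℝ) / M < 1 := fun j hj =>
    ⟨by positivity, (div_lt_one hM').2 (by exact_mod_cast Finset.mem_range.1 hj)⟩
  -- Evenness of `σ` enters here: `m` is an integer and the shift is less than one, so rounding
  -- cannot exceed `m`.
  have hfloor : ∀ j ∈ Finset.range M, ∀ a : ℝ, 0 ≤ a → a ≤ m → ⌊a + j / M⌋₊ ≤ m := by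
    intro j hj a ha ham
    have := hfrac j hj
    exact Nat.lt_succ_iff.1 ((Nat.floor_lt (by linarith)).2 (by push_cast; linarith))
  have hfloor0 : ∀ j ∈ Finset.range M, ⌊(0 : ℝ) + j / M⌋₊ = 0 := fun j hj =>
    Nat.floor_eq_zero.2 (by simpa using (hfrac j hj).2)
  have hex : ∀ j ∈ Finset.range M, ∃ y : L2star T, rep y =ᵐ[volume.restrict (Iio T)]
      fun t => (⌊rep z t + j / M⌋₊ : ℝ) - ⌊rep w t + j / M⌋₊ := by
    intro j hj
    refine exists_rep_ae_eq (C := 1) ((aestronglyMeasurable_floor_rep z _).sub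
      (aestronglyMeasurable_floor_rep w _)) ?_ ?_
    · filter_upwards [hG] with t ht
      obtain ⟨-, -, h3, -, h5, h6, -, -⟩ := id ht
      rcases floor_add_sub_floor_add_mem (a := rep z t) (b := rep w t) (c := j / M) (hwnn t ht)
        (hfrac j hj).1 (by linarith) (by linarith) with h | h
      · rw [h]; simp
      · rw [mem_singleton_iff.1 h]; simp
    · filter_upwards [hG] with t ht h
      rw [hwneg t ht h, (ht.2.2.2.1 h).1, sub_self]
  choose! y hy using hex
  have hmem : ∀ j ∈ Finset.range M, y j ∈ {u | u ∈ switches T (2 * m) ∧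
      ∀ N : ℕ, (∀ c, x c ∈ stepFunctions T N) → u ∈ stepFunctions T N} := by
    intro j hj
    have hvar : variation (y j) ≤ ((2 * m : ℕ) : ℝ≥0∞) := by
      refine variation_le_of_sub (f := fun t => ⌊rep z t + j / M⌋₊)
        (g := fun t => ⌊rep w t + j / M⌋₊) hG hGT ?_ ?_ ?_ ?_ ?_ ?_
        (aestronglyMeasurable_floor_rep z _) (aestronglyMeasurable_floor_rep w _) (hy j hj)
      · exact fun a ha b hb hab => Nat.floor_mono (by linarith [hzG ha hb hab])
      · exact fun t ht => hfloor j hj _ ht.2.2.2.2.2.2.1 ht.2.2.2.2.2.2.2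
      · exact fun t ht h => by simp only [(ht.2.2.2.1 h).1, hfloor0 j hj]
      · exact fun a ha b hb hab => Nat.floor_mono (by linarith [hwG ha hb hab])
      · exact fun t ht => hfloor j hj _ (hwnn t ht) (by linarith [ht.2.2.1, ht.2.2.2.2.1,
          ht.2.2.2.2.2.2.2])
      · exact fun t ht h => by simp only [hwneg t ht h, hfloor0 j hj]
    refine ⟨⟨⟨?_, hvar.trans_lt (ENNReal.natCast_lt_top _)⟩, hvar⟩, fun N hN => ?_⟩
    · refine ae_restrict_Ioo_iff.2 ?_
      filter_upwards [hG, hy j hj] with t ht hyt _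
      obtain ⟨-, -, h3, -, h5, h6, -, -⟩ := id ht
      rw [hyt]
      exact floor_add_sub_floor_add_mem (hwnn t ht) (hfrac j hj).1 (by linarith) (by linarith)
    · obtain ⟨v, hv⟩ := hN 0
      obtain ⟨v', hv'⟩ := hN 1
      -- Rounding is pointwise, so it can be carried out on the cell values of `u` and `z`.
      refine ⟨fun i => (⌊v' i + j / M⌋₊ : ℝ) - ⌊v' i - v i + j / M⌋₊, fun i => ?_⟩
      filter_upwards [hv i, hv' i, ae_cell_of_ae hT i (hy j hj), ae_cell_of_ae hT i hG]
        with t h1 h2 h3 h4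
      rw [h3, h4.2.2.1, hz_def, hu_def, h1, h2]
  refine ⟨∑ j ∈ Finset.range M, (M : ℝ)⁻¹ • y j, ?_, ?_⟩
  · refine (convex_convexHull ℝ _).sum_mem (fun _ _ => (inv_pos.2 hM').le) ?_
      fun j hj => subset_convexHull ℝ _ (hmem j hj)
    rw [Finset.sum_const, Finset.card_range, nsmul_eq_mul, mul_inv_cancel₀ hM'.ne']
  · have hnorm : (M : ℝ)⁻¹ * ‖one T‖ = ‖(M : ℝ)⁻¹ • one T‖ := by
      rw [norm_smul, Real.norm_of_nonneg (inv_pos.2 hM').le]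
    rw [hnorm]
    refine Lp.norm_le_norm_of_ae_le
      (f := ((u - ∑ j ∈ Finset.range M, (M : ℝ)⁻¹ • y j : L2star T) : L2 T))
      (g := (((M : ℝ)⁻¹ • one T : L2star T) : L2 T)) ?_
    have hyall : ∀ᵐ t ∂(volume.restrict (Iio T)), ∀ j, j ∈ Finset.range M →
        rep ((M : ℝ)⁻¹ • y j) t =
          (M : ℝ)⁻¹ * ((⌊rep z t + j / M⌋₊ : ℝ) - ⌊rep w t + j / M⌋₊) := by
      refine ae_all_iff.2 fun j => ?_
      by_cases hj : j ∈ Finset.range M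
      · filter_upwards [hy j hj, rep_smul (M : ℝ)⁻¹ (y j)] with t h1 h2 _
        rw [h2, h1]
      · exact .of_forall fun _ h => (hj h).elim
    filter_upwards [hG, rep_sub u (∑ j ∈ Finset.range M, (M : ℝ)⁻¹ • y j),
      rep_sum (Finset.range M) (fun j => (M : ℝ)⁻¹ • y j), hyall, rep_smul (M : ℝ)⁻¹ (one T),
      rep_one T] with t ht h1 h2 h3 h4 h5
    show ‖rep _ t‖ ≤ ‖rep _ t‖
    rw [h1, h2, h4, h5, Finset.sum_congr rfl fun j hj => h3 j hj]
    rcases le_or_gt 0 t with h | h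
    · rw [indicator_of_mem (show t ∈ Ici 0 from h), Pi.one_apply, mul_one, norm_sub_rev,
        Real.norm_of_nonneg (inv_pos.2 hM').le]
      have h6 : rep u t = rep z t - rep w t := by rw [ht.2.2.1]; ring
      rw [h6]
      exact abs_average_floor_sub_le ht.2.2.2.2.2.2.1 (hwnn t ht) hM
    · rw [Finset.sum_eq_zero fun j hj => ?_, (ht.2.2.2.1 h).2, sub_zero, norm_zero]
      · exact norm_nonneg _
      · rw [hwneg t ht h, (ht.2.2.2.1 h).1, sub_self, mul_zero]

theorem mem_closure_convexHull {m : ℕ} (hT : 0 < T) {x : Fin (1 + 1) → L2star T}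
    (hx : x ∈ switchesExt T (2 * m)) :
    x 0 ∈ closure (convexHull ℝ {u | u ∈ switches T (2 * m) ∧
        ∀ N : ℕ, (∀ c, x c ∈ stepFunctions T N) → u ∈ stepFunctions T N}) := by
  rw [Metric.mem_closure_iff]
  intro ε hε
  have hlim : Tendsto (fun M : ℕ => (M : ℝ)⁻¹ * ‖one T‖) atTop (𝓝 0) := by
    simpa using (tendsto_inv_atTop_nhds_zero_nat (𝕜 := ℝ)).mul_const ‖one T‖
  obtain ⟨M, hM, hM0⟩ := ((hlim.eventually (gt_mem_nhds hε)).and (eventually_gt_atTop 0)).exists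
  obtain ⟨y, hy, hle⟩ := exists_convexHull_near hT hx hM0
  exact ⟨y, hy, by rw [dist_eq_norm]; exact hle.trans_lt hM⟩

theorem mem_closure_convexHull_switches {m : ℕ} (hT : 0 < T) {x : Fin (1 + 1) → L2star T}
    (hx : x ∈ switchesExt T (2 * m)) : x 0 ∈ closure (convexHull ℝ (switches T (2 * m))) :=
  closure_mono (convexHull_mono fun _ h => h.1) (mem_closure_convexHull hT hx)

/-- The approximating switches live on the same grid, where the convex hull is closed; so the
closure can be dropped. -/
theorem mem_convexHull_discretize {m N : ℕ} (hT : 0 < T) (hN : 0 < N)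
    {x : Fin (1 + 1) → L2star T} (hx : x ∈ discretizeTuple (switchesExt T (2 * m)) N) :
    x 0 ∈ convexHull ℝ (discretize (switches T (2 * m)) N) := by
  rw [← ((discretize_switches_finite hT hN (2 * m)).isCompact_convexHull ℝ).isClosed.closure_eq]
  refine closure_mono (convexHull_mono ?_) (mem_closure_convexHull hT hx.1)
  exact fun _ h => ⟨h.1, h.2 N hx.2⟩

/-! ### Counting the jumps of a switch -/

/-- `UpChain f G k t` says that there are `k` successive pairs of points of `G`, the last of which
is `t`, where `f` has the values `0` and `1`. -/
inductive UpChain (f : ℝ → ℝ) (G : Set ℝ) : ℕ → ℝ → Prop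
  | nil (t : ℝ) : UpChain f G 0 t
  | cons {k : ℕ} {r s t : ℝ} (h : UpChain f G k r) (hrs : r < s) (hst : s < t) (hs : s ∈ G)
      (ht : t ∈ G) (hfs : f s = 0) (hft : f t = 1) : UpChain f G (k + 1) t

/-- This builds oscillating test functions one jump at a time: a jump of height `c` at a regular
point `s` adds `c * rep u s` to the limit. Only the derivatives need compact support until the very
end. -/
theorem tendsto_integral_add_smoothStep {u : L2star T} {Φ : ℝ → ℝ → ℝ} {L c s : ℝ}
    (hΦ : ∀ δ, ContDiff ℝ (⊤ : ℕ∞) (Φ δ))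
    (hsupp : ∀ᶠ δ in 𝓝[>] 0, HasCompactSupport (deriv (Φ δ)))
    (hlim : Tendsto (fun δ => ∫ t in Iio T, rep u t * deriv (Φ δ) t) (𝓝[>] 0) (𝓝 L))
    (hs : s ∈ regularPoints u) :
    (∀ δ, ContDiff ℝ (⊤ : ℕ∞) fun t => Φ δ t + c * smoothStep s δ t) ∧
    (∀ᶠ δ in 𝓝[>] 0, HasCompactSupport (deriv fun t => Φ δ t + c * smoothStep s δ t)) ∧
    Tendsto (fun δ => ∫ t in Iio T, rep u t * deriv (fun t => Φ δ t + c * smoothStep s δ t) t)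
      (𝓝[>] 0) (𝓝 (L + c * rep u s)) := by
  have hd : ∀ δ, deriv (fun t => Φ δ t + c * smoothStep s δ t) =
      fun t => deriv (Φ δ) t + c * deriv (smoothStep s δ) t := by
    intro δ
    funext t
    have h1 := (contDiff_smoothStep s δ).differentiable (by simp) t
    rw [deriv_fun_add ((hΦ δ).differentiable (by simp) t) (h1.const_mul c),
      deriv_const_mul _ h1]
  refine ⟨fun δ => (hΦ δ).add (contDiff_const.mul (contDiff_smoothStep s δ)), ?_, ?_⟩
  · filter_upwards [hsupp, self_mem_nhdsWithin] with δ h1 (hδ : 0 < δ)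
    rw [hd]
    exact h1.add (hasCompactSupport_deriv_smoothStep s hδ).mul_left
  · refine (hlim.add (hs.2.const_mul c)).congr' ?_
    filter_upwards [hsupp, self_mem_nhdsWithin] with δ h1 (hδ : 0 < δ)
    have hi1 := integrable_rep_mul u ((hΦ δ).continuous_deriv (by simp)) h1
    have hi2 := integrable_rep_mul u (continuous_deriv_smoothStep s δ)
      (hasCompactSupport_deriv_smoothStep s hδ)
    rw [← integral_const_mul, ← integral_add hi1 (hi2.const_mul c), hd]
    refine integral_congr_ae (.of_forall fun t => ?_)
    show _ = rep u t * (_ + _)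
    ring

/-- A chain of `k` pairs is detected by test functions up to the compactness of their support. -/
theorem UpChain.exists_test {u : L2star T} {G : Set ℝ} (hG : G ⊆ regularPoints u) {k : ℕ} {r : ℝ}
    (h : UpChain (rep u) G k r) :
    ∃ (Φ : ℝ → ℝ → ℝ) (a : ℝ), (∀ δ, ContDiff ℝ (⊤ : ℕ∞) (Φ δ)) ∧
      (∀ᶠ δ in 𝓝[>] 0, HasCompactSupport (deriv (Φ δ))) ∧
      (∀ᶠ δ in 𝓝[>] 0, (∀ t, |Φ δ t| ≤ 1) ∧ (∀ t ≤ a, Φ δ t = 1) ∧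
        ∀ t, r + δ ≤ t → Φ δ t = 1) ∧
      Tendsto (fun δ => ∫ t in Iio T, rep u t * deriv (Φ δ) t) (𝓝[>] 0) (𝓝 (2 * k)) := by
  induction h with
  | nil t =>
    refine ⟨fun _ _ => 1, 0, fun _ => contDiff_const, .of_forall fun _ => ?_, ?_, ?_⟩
    · simp only [deriv_const']
      exact HasCompactSupport.zero
    · simp
    · simp
  | @cons k r s t h hrs hst hs ht hfs hft ih =>
    obtain ⟨Φ, a, h1, h2, h3, h4⟩ := ih
    obtain ⟨h1', h2', h4'⟩ := tendsto_integral_add_smoothStep (c := -2) h1 h2 h4 (hG hs)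
    obtain ⟨h1'', h2'', h4''⟩ := tendsto_integral_add_smoothStep (c := 2) h1' h2' h4' (hG ht)
    -- The test function falls from `1` to `-1` at `s`, where `u = 0`, and returns to `1` at `t`,
    -- where `u = 1`; the gain is `2`. For `δ < s - r` the earlier jumps are completed before `s`,
    -- which keeps the values in `[-1, 1]`.
    refine ⟨fun δ x => Φ δ x + -2 * smoothStep s δ x + 2 * smoothStep t δ x, min a s, h1'', h2'',
      ?_, ?_⟩
    · filter_upwards [h3, self_mem_nhdsWithin, Ioo_mem_nhdsGT (sub_pos.2 hrs)]
        with δ ⟨h5, h6, h7⟩ (hδ : 0 < δ) hδ2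
      refine ⟨fun x => ?_, fun x hx => ?_, fun x hx => ?_⟩
      · rcases le_total x s with hx | hx
        · rw [smoothStep_of_le hδ hx, smoothStep_of_le hδ (hx.trans hst.le)]
          simpa using h5 x
        · rw [h7 x (by linarith [hδ2.2]), abs_le]
          have := smoothStep_anti hδ hst.le x
          have := smoothStep_le_one s δ x
          have := smoothStep_nonneg t δ x
          constructor <;> linarith
      · have hxs := hx.trans (min_le_right _ _)
        rw [smoothStep_of_le hδ hxs, smoothStep_of_le hδ (hxs.trans hst.le),
          h6 x (hx.trans (min_le_left _ _))]
        ring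
      · rw [smoothStep_of_ge hδ hx, smoothStep_of_ge hδ (by linarith), h7 x (by linarith)]
        ring
    · convert h4'' using 2
      rw [hfs, hft]
      push_cast
      ring

/-- The variation bounds the length of chains. -/
theorem UpChain.le_variation {u : L2star T} {G : Set ℝ} (hG : G ⊆ regularPoints u) {k σ : ℕ}
    {t : ℝ} (h : UpChain (rep u) G (k + 1) t) (hσ : variation u ≤ (σ : ℝ≥0∞)) :
    2 * k + 1 ≤ σ := by
  cases h with
  | @cons _ r s t h hrs hst hs ht hfs hft =>
  obtain ⟨Φ, a, h1, h2, h3, h4⟩ := h.exists_test hG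
  obtain ⟨h1', h2', h4'⟩ := tendsto_integral_add_smoothStep (c := -2) h1 h2 h4 (hG hs)
  -- The last rise leads from `-1` only to `0`, because a test function must vanish near `T`. So the
  -- last pair contributes `1` instead of `2`.
  obtain ⟨h1'', h2'', h4''⟩ := tendsto_integral_add_smoothStep (c := 1) h1' h2' h4' (hG ht)
  rw [hfs, hft] at h4''
  -- On the left the test function is cut off from `1` to `0` below `b ≤ -1`, where `u` vanishes and
  -- the integral is not affected.
  set b := min (min a s) (-1) with hb
  have hba : b ≤ a := (min_le_left _ _).trans (min_le_left _ _)
  have hbs : b ≤ s := (min_le_left _ _).trans (min_le_right _ _)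
  have hb1 : b ≤ -1 := min_le_right _ _
  have hlim : (2 * k + 1 : ℝ) ≤ σ := by
    have e : (2 * k + 1 : ℝ) = 2 * k + -2 * 0 + 1 * 1 := by ring
    rw [e]
    refine le_of_tendsto h4'' ?_
    filter_upwards [h3, self_mem_nhdsWithin, Ioo_mem_nhdsGT (sub_pos.2 hrs),
      Ioo_mem_nhdsGT (sub_pos.2 (hG ht).1), h2''] with δ ⟨h5, h6, h7⟩ (hδ : 0 < δ) hδ2 hδ3 hsupp
    set F : ℝ → ℝ := fun x => Φ δ x + -2 * smoothStep s δ x + 1 * smoothStep t δ x with hF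
    have hcont : ContDiff ℝ (⊤ : ℕ∞) fun x => F x - (1 - smoothStep (b - 1) 1 x) :=
      (h1'' δ).sub (contDiff_const.sub (contDiff_smoothStep (b - 1) 1))
    have hFs : ∀ x ≤ s, F x = Φ δ x := fun x hx => by
      rw [hF]
      simp only
      rw [smoothStep_of_le hδ hx, smoothStep_of_le hδ (hx.trans hst.le)]
      ring
    have hFt : ∀ x, t + δ ≤ x → F x = 0 := fun x hx => by
      rw [hF]
      simp only
      rw [smoothStep_of_ge hδ hx, smoothStep_of_ge hδ (by linarith), h7 x (by linarith)]
      ring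
    let φ : 𝓓(domain T, ℝ) := testOfIcc (a := b - 1) (b := t + δ) hcont (by linarith [hδ3.2])
      (fun x hx => by
        rw [hFs x (by linarith), h6 x (by linarith), smoothStep_of_le one_pos hx]; ring)
      (fun x hx => by
        rw [hFt x hx, smoothStep_of_ge one_pos (by linarith)]; ring)
    have hφ : ∀ x, |φ x| ≤ 1 := by
      intro x
      show |F x - (1 - smoothStep (b - 1) 1 x)| ≤ 1
      rcases le_total x b with hx | hx
      · rw [hFs x (by linarith), h6 x (by linarith), abs_le]
        have := smoothStep_nonneg (b - 1) 1 x
        have := smoothStep_le_one (b - 1) 1 x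
        constructor <;> linarith
      · rw [smoothStep_of_ge one_pos (show b - 1 + 1 ≤ x by linarith), sub_self, sub_zero]
        rcases le_total x s with hxs | hxs
        · rw [hFs x hxs]
          exact h5 x
        · rw [hF]
          simp only
          rw [h7 x (by linarith [hδ2.2]), abs_le]
          have := smoothStep_anti hδ hst.le x
          have := smoothStep_le_one s δ x
          have := smoothStep_nonneg t δ x
          constructor <;> linarith
    refine le_trans (le_of_eq ?_) (variation_le_iff.1 hσ φ hφ)
    rw [pairing_apply]
    refine integral_congr_ae ?_
    filter_upwards [rep_eq_zero_of_neg u] with x hx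
    rcases lt_or_ge x 0 with h | h
    · rw [hx h, zero_mul, zero_mul]
    · congr 1
      have : φ =ᶠ[𝓝 x] F := by
        filter_upwards [Ioi_mem_nhds (show b < x by linarith)] with y (hy : b < y)
        show F y - (1 - smoothStep (b - 1) 1 y) = F y
        rw [smoothStep_of_ge one_pos (by linarith)]
        ring
      rw [this.deriv_eq]
  exact_mod_cast hlim

/-- The number of upward jumps of `f` on `G` up to time `t`. -/
def upCount (f : ℝ → ℝ) (G : Set ℝ) (t : ℝ) : ℕ := sSup {k | ∃ r ≤ t, UpChain f G k r}

section UpCount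

variable {f : ℝ → ℝ} {G : Set ℝ} {m : ℕ}

theorem bddAbove_chains (hm : ∀ k r, UpChain f G k r → k ≤ m) (t : ℝ) :
    BddAbove {k | ∃ r ≤ t, UpChain f G k r} :=
  ⟨m, fun k ⟨r, _, h⟩ => hm k r h⟩

theorem upCount_spec (hm : ∀ k r, UpChain f G k r → k ≤ m) (t : ℝ) :
    ∃ r ≤ t, UpChain f G (upCount f G t) r :=
  Nat.sSup_mem (s := {k | ∃ r ≤ t, UpChain f G k r}) ⟨0, t, le_rfl, .nil t⟩ (bddAbove_chains hm t)

theorem le_upCount (hm : ∀ k r, UpChain f G k r → k ≤ m) {k : ℕ} {r t : ℝ} (hrt : r ≤ t)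
    (h : UpChain f G k r) : k ≤ upCount f G t :=
  le_csSup (bddAbove_chains hm t) ⟨r, hrt, h⟩

theorem upCount_le (hm : ∀ k r, UpChain f G k r → k ≤ m) (t : ℝ) : upCount f G t ≤ m := by
  obtain ⟨r, -, h⟩ := upCount_spec hm t
  exact hm _ _ h

theorem monotone_upCount (hm : ∀ k r, UpChain f G k r → k ≤ m) : Monotone (upCount f G) := by
  intro s t hst
  obtain ⟨r, hr, h⟩ := upCount_spec hm s
  exact le_upCount hm (hr.trans hst) h

/-- A longest chain up to `s` is prolonged by the pair `(s, t)`. It cannot end at `s` itself unless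
it is empty, because non-empty chains end where `f = 1`; an empty chain may be restarted at any
earlier point. -/
theorem upCount_add_one_le (hm : ∀ k r, UpChain f G k r → k ≤ m) {s t : ℝ} (hs : s ∈ G)
    (ht : t ∈ G) (hst : s < t) (hfs : f s = 0) (hft : f t = 1) :
    upCount f G s + 1 ≤ upCount f G t := by
  obtain ⟨r, hr, h⟩ := upCount_spec hm s
  refine le_upCount hm le_rfl ?_
  rcases hr.lt_or_eq with hr | rfl
  · exact h.cons hr hst hs ht hfs hft
  · generalize upCount f G r = n at h
    cases h with
    | nil => exact (UpChain.nil (r - 1)).cons (by linarith) hst hs ht hfs hft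
    | cons _ _ _ _ _ _ h => rw [hfs] at h; exact absurd h zero_ne_one

theorem upCount_of_neg (hm : ∀ k r, UpChain f G k r → k ≤ m)
    (h0 : ∀ t ∈ G, t < 0 → f t = 0) {t : ℝ} (ht : t < 0) : upCount f G t = 0 := by
  obtain ⟨r, hr, h⟩ := upCount_spec hm t
  generalize upCount f G t = n at h
  cases h with
  | nil => rfl
  | cons _ _ _ _ hr' _ h => rw [h0 r hr' (hr.trans_lt ht)] at h; exact absurd h zero_ne_one

/-- The number of jumps does not change where `f` is constant. -/
theorem upCount_eq_of_const (hm : ∀ k r, UpChain f G k r → k ≤ m) {s t : ℝ} (hs : s ∈ G)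
    (hst : s ≤ t) (hconst : ∀ r ∈ G, s ≤ r → r ≤ t → f r = f s) :
    upCount f G t = upCount f G s := by
  refine le_antisymm ?_ (monotone_upCount hm hst)
  obtain ⟨r, hr, h⟩ := upCount_spec hm t
  generalize upCount f G t = n at h
  cases h with
  | nil => exact Nat.zero_le _
  | @cons k r' s' _ h h1 h2 h3 h4 h5 h6 =>
    rcases le_or_gt r s with hrs | hrs
    · exact le_upCount hm hrs (h.cons h1 h2 h3 h4 h5 h6)
    -- If the longest chain ends after `s`, then `f = 1` already at `s`, and the zero of the last
    -- pair lies before `s`. So the end of the chain can be moved back to `s`.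
    · have h7 : f s = 1 := by rw [← hconst r h4 hrs.le hr, h6]
      have h8 : s' < s := by
        by_contra hc
        have := hconst s' h3 (not_lt.1 hc) (h2.le.trans hr)
        rw [h5, h7] at this
        exact zero_ne_one this
      exact le_upCount hm le_rfl (h.cons h1 h8 h3 hs h5 h7)

end UpCount

/-- The distributional derivative is a sum of positive point masses. -/
theorem derivLE_zero_of_monotoneOn {f : ℝ → ℕ} {G : Set ℝ} {m : ℕ}
    (hG : ∀ᵐ t ∂(volume.restrict (Iio T)), t ∈ G) (hGT : G ⊆ Iio T) (hmono : MonotoneOn f G)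
    (hm : ∀ t ∈ G, f t ≤ m) (h0 : ∀ t ∈ G, t < 0 → f t = 0) {w : L2star T}
    (hw : rep w =ᵐ[volume.restrict (Iio T)] fun t => (f t : ℝ)) : DerivLE 0 w := by
  obtain ⟨a, ha⟩ := exists_integral_mul_deriv_eq hG hGT hmono hm h0
  rw [derivLE_iff]
  intro φ hφ
  have e : ∀ᵐ t ∂(volume.restrict (Iio T)), rep w t * deriv φ t = (f t : ℝ) * deriv φ t := by
    filter_upwards [hw] with t ht
    rw [ht]
  rw [map_zero, pairing_apply, integral_congr_ae e, ha, neg_nonpos]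
  exact Finset.sum_nonneg fun k _ => hφ _

/-- Every switch is the projection of a point of the extended formulation, which is piecewise
constant if the switch is. -/
theorem exists_mem_switchesExt (hT : 0 < T) {m : ℕ} {u : L2star T}
    (hu : u ∈ switches T (2 * m)) :
    ∃ x ∈ switchesExt T (2 * m), x 0 = u ∧
      ∀ N : ℕ, u ∈ stepFunctions T N → ∀ c, x c ∈ stepFunctions T N := by
  obtain ⟨⟨hbin, -⟩, hvar⟩ := hu
  -- Cell values are fixed for all grids at once, so that one set `G` of full measure, and hence one
  -- counter `z`, serves every `N`.
  have hstep : ∀ N : ℕ, ∃ v : Fin N → ℝ, u ∈ stepFunctions T N → IsStep N v u := fun N => by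
    by_cases h : u ∈ stepFunctions T N
    · exact ⟨h.choose, fun _ => h.choose_spec⟩
    · exact ⟨0, fun h' => (h h').elim⟩
  choose v hv using hstep
  set G : Set ℝ := {t | t ∈ regularPoints u ∧ (t < 0 → rep u t = 0) ∧
    (rep u t = 0 ∨ rep u t = 1) ∧ ∀ N : ℕ, u ∈ stepFunctions T N → ∀ i : Fin N,
      t ∈ Ioo ((i : ℝ) * (T / N)) (((i : ℝ) + 1) * (T / N)) → rep u t = v N i} with hG_def
  have hG : ∀ᵐ t ∂(volume.restrict (Iio T)), t ∈ G := by
    have hcells : ∀ᵐ t ∂(volume.restrict (Iio T)), ∀ N : ℕ, u ∈ stepFunctions T N →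
        ∀ i : Fin N, t ∈ Ioo ((i : ℝ) * (T / N)) (((i : ℝ) + 1) * (T / N)) →
          rep u t = v N i := by
      refine ae_restrict_of_ae (ae_all_iff.2 fun N => ?_)
      by_cases h : u ∈ stepFunctions T N
      · filter_upwards [ae_all_iff.2 fun i => (ae_restrict_iff' measurableSet_Ioo).1 (hv N h i)]
          with t ht _ using ht
      · exact .of_forall fun _ h' => (h h').elim
    filter_upwards [ae_mem_regularPoints u, rep_eq_zero_of_neg u, ae_restrict_Ioo_iff.1 hbin,
      hcells] with t h1 h2 h3 h4
    refine ⟨h1, h2, ?_, h4⟩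
    rcases le_or_gt 0 t with h | h
    · exact h3 h
    · exact Or.inl (h2 h)
  have hGT : G ⊆ Iio T := fun t ht => ht.1.1
  have hGr : G ⊆ regularPoints u := fun t ht => ht.1
  -- Parity: a chain of length `k + 1` only forces `2k + 1 ≤ 2m`, but this already implies `k + 1 ≤
  -- m`.
  have hm : ∀ k r, UpChain (rep u) G k r → k ≤ m := by
    intro k r h
    rcases k with _ | k
    · exact Nat.zero_le _
    · have := h.le_variation hGr hvar
      omega
  set n := upCount (rep u) G with hn_def
  have hn0 : ∀ t, t < 0 → n t = 0 := fun t => upCount_of_neg hm fun t ht => ht.2.1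
  have hnm : ∀ t, n t ≤ m := upCount_le hm
  have hnmono : Monotone n := monotone_upCount hm
  have hle : ∀ t ∈ G, rep u t = 1 → 1 ≤ n t := by
    obtain ⟨s, hs, hs0⟩ := exists_neg_mem hT hG
    intro t ht h1
    have hst : s < t := by
      by_contra hc
      have := ht.2.1 ((not_lt.1 hc).trans_lt hs0)
      rw [h1] at this
      exact one_ne_zero this
    exact (Nat.le_add_left 1 _).trans (upCount_add_one_le hm hs ht hst (hs.2.1 hs0) h1)
  obtain ⟨z, hz⟩ : ∃ z : L2star T, rep z =ᵐ[volume.restrict (Iio T)] fun t => (n t : ℝ) := by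
    refine exists_rep_ae_eq (C := m) ?_ (.of_forall fun t => ?_) (.of_forall fun t ht => ?_)
    · have : Monotone fun t => (n t : ℝ) := fun s t h => Nat.cast_le.2 (hnmono h)
      exact this.measurable.aestronglyMeasurable
    · rw [Nat.abs_cast]
      exact_mod_cast hnm t
    · rw [hn0 t ht, Nat.cast_zero]
  refine ⟨![u, z], ⟨?_, ?_, ?_, ?_⟩, rfl, ?_⟩
  · show u ∈ _
    refine ae_restrict_Ioo_iff.2 ?_
    filter_upwards [ae_restrict_Ioo_iff.1 hbin] with t ht h0
    rcases ht h0 with h | h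
    · simp [h]
    · simp [mem_singleton_iff.1 h]
  · show z ∈ _
    refine ae_restrict_Ioo_iff.2 ?_
    filter_upwards [hz] with t ht _
    rw [ht]
    refine ⟨Nat.cast_nonneg _, ?_⟩
    have : (n t : ℝ) ≤ m := by exact_mod_cast hnm t
    push_cast
    linarith
  · show DerivLE u z
    rw [← derivLE_zero_sub]
    classical
    -- `z - u` counts downward jumps. The truncated subtraction is exact on `G`, because `n ≥ 1`
    -- wherever `u = 1`.
    refine derivLE_zero_of_monotoneOn (f := fun t => n t - if rep u t = 1 then 1 else 0) (m := m)
      hG hGT ?_ ?_ ?_ ?_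
    · intro s hs t ht hst
      show n s - _ ≤ n t - _
      have h1 := hnmono hst
      rcases hs.2.2.1 with h2 | h2 <;> rcases ht.2.2.1 with h3 | h3 <;> simp only [h2, h3]
      · simpa using h1
      · rcases hst.eq_or_lt with rfl | hst
        · rw [h2] at h3; exact absurd h3 zero_ne_one
        · have : n s + 1 ≤ n t := upCount_add_one_le hm hs ht hst h2 h3
          simp only [zero_ne_one, if_false, if_true]
          omega
      · simp only [zero_ne_one, if_false, if_true]
        omega
      · simp only [if_true]
        omega
    · exact fun t _ => (Nat.sub_le _ _).trans (hnm t)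
    · exact fun t _ h => by simp only [hn0 t h, Nat.zero_sub]
    · filter_upwards [rep_sub z u, hz, hG] with t h1 h2 h3
      rw [h1, h2]
      rcases h3.2.2.1 with h4 | h4
      · simp [h4]
      · rw [if_pos h4, Nat.cast_sub (hle t h3 h4), h4, Nat.cast_one]
  · show DerivLE 0 z
    exact derivLE_zero_of_monotoneOn hG hGT (hnmono.monotoneOn G) (fun t _ => hnm t)
      (fun t _ => hn0 t) hz
  · intro N hN c
    fin_cases c
    · exact hN
    · show z ∈ stepFunctions T N
      have hcell : ∀ i : Fin N,
          ∃ s ∈ G, s ∈ Ioo ((i : ℝ) * (T / N)) (((i : ℝ) + 1) * (T / N)) := by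
        intro i
        have := cell_neZero hT i
        exact ((ae_cell_of_ae hT i hG).and (ae_restrict_mem measurableSet_Ioo)).exists
      choose s hsG hs using hcell
      refine ⟨fun i => n (s i), fun i => ?_⟩
      have key : ∀ a ∈ G, ∀ b ∈ G, a ∈ Ioo ((i : ℝ) * (T / N)) (((i : ℝ) + 1) * (T / N)) →
          b ∈ Ioo ((i : ℝ) * (T / N)) (((i : ℝ) + 1) * (T / N)) → a ≤ b → n b = n a := by
        intro a ha b hb hai hbi hab
        refine upCount_eq_of_const hm ha hab fun r hr har hrb => ?_
        rw [ha.2.2.2 N hN i hai, hr.2.2.2 N hN i ⟨hai.1.trans_le har, hrb.trans_lt hbi.2⟩]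
      filter_upwards [ae_cell_of_ae hT i hz, ae_cell_of_ae hT i hG,
        ae_restrict_mem measurableSet_Ioo] with t h1 h2 h3
      rw [h1]
      rcases le_total (s i) t with h | h
      · rw [key _ (hsG i) _ h2 (hs i) h3 h]
      · rw [key _ h2 _ (hsG i) h3 (hs i) h]

/-! ### Closedness of the projection -/

/-- Bounded sequences in Hilbert spaces converge weakly along ultrafilters. -/
theorem exists_weak_limit {H : Type*} [NormedAddCommGroup H] [InnerProductSpace ℝ H]
    [CompleteSpace H] {z : ℕ → H} {R : ℝ} (hz : ∀ n, ‖z n‖ ≤ R) :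
    ∃ w : H, ∀ g : H,
      Tendsto (fun n => inner ℝ (z n) g) (hyperfilter ℕ : Filter ℕ) (𝓝 (inner ℝ w g)) := by
  let f : ℕ → WeakDual ℝ H := fun n => StrongDual.toWeakDual (InnerProductSpace.toDual ℝ H (z n))
  have hK := WeakDual.isCompact_closedBall (𝕜 := ℝ) (E := H) 0 R
  obtain ⟨x, -, hx⟩ := hK.ultrafilter_le_nhds ((hyperfilter ℕ).map f) (by
    rw [le_principal_iff]
    refine mem_map.2 (univ_mem' fun n => ?_)
    show InnerProductSpace.toDual ℝ H (z n) ∈ Metric.closedBall 0 R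
    rw [mem_closedBall_zero_iff, LinearIsometryEquiv.norm_map]
    exact hz n)
  refine ⟨(InnerProductSpace.toDual ℝ H).symm (WeakDual.toStrongDual x), fun g => ?_⟩
  rw [InnerProductSpace.toDual_symm_apply]
  have h1 : Tendsto f (hyperfilter ℕ : Filter ℕ) (𝓝 x) := hx
  exact ((WeakDual.eval_continuous g).tendsto x).comp h1

theorem inner_eq_integral (v g : L2 T) : inner ℝ v g = ∫ t in Iio T, v t * g t := by
  rw [L2.inner_def]
  refine integral_congr_ae (.of_forall fun t => ?_)
  simp [mul_comm]

theorem inner_nonneg_of_nonneg {v g : L2 T} (hv : 0 ≤ v) (hg : 0 ≤ g) : 0 ≤ inner ℝ v g := by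
  rw [inner_eq_integral]
  refine integral_nonneg_of_ae ?_
  filter_upwards [(Lp.coeFn_nonneg v).2 hv, (Lp.coeFn_nonneg g).2 hg] with t h1 h2
  exact mul_nonneg h1 h2

/-- Testing with the negative part of `v` gives minus its squared norm, so the negative part
vanishes. -/
theorem nonneg_of_inner_nonneg {v : L2 T} (h : ∀ g : L2 T, 0 ≤ g → 0 ≤ inner ℝ v g) : 0 ≤ v := by
  have hneg := Lp.coeFn_negPart v
  have hg : 0 ≤ Lp.negPart v := by
    rw [← Lp.coeFn_nonneg]
    filter_upwards [hneg] with t ht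
    rw [ht]
    simp
  have e : inner ℝ v (Lp.negPart v) = -inner ℝ (Lp.negPart v) (Lp.negPart v) := by
    rw [inner_eq_integral, inner_eq_integral, ← integral_neg]
    refine integral_congr_ae ?_
    filter_upwards [hneg] with t ht
    rw [ht]
    rcases le_total (v t) 0 with h0 | h0
    · rw [min_eq_left h0]; ring
    · rw [min_eq_right h0]; ring
  have h1 := h _ hg
  rw [e, real_inner_self_eq_norm_sq] at h1
  have h2 : Lp.negPart v = 0 := by
    rw [← norm_eq_zero]
    nlinarith [norm_nonneg (Lp.negPart v)]
  rw [← Lp.coeFn_nonneg]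
  rw [h2] at hneg
  filter_upwards [hneg, Lp.coeFn_zero ℝ 2 (volume.restrict (Iio T))] with t h3 h4
  rw [h4] at h3
  have : min (v t) 0 = 0 := by simpa using h3.symm
  exact min_eq_right_iff.1 this

theorem nonneg_of_tendsto_inner {F : Filter ℕ} [F.NeBot] {y : ℕ → L2 T} {w : L2 T}
    (hy : ∀ n, 0 ≤ y n)
    (hlim : ∀ g : L2 T, Tendsto (fun n => inner ℝ (y n) g) F (𝓝 (inner ℝ w g))) : 0 ≤ w :=
  nonneg_of_inner_nonneg fun g hg =>
    ge_of_tendsto' (hlim g) fun n => inner_nonneg_of_nonneg (hy n) hg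

/-- In this form the box constraints are order relations in `L²(-∞, T)`, which pass to weak limits.
-/
theorem mem_L2starIn_Icc_iff {c : ℝ} {u : L2star T} :
    u ∈ L2starIn T (Icc 0 c) ↔
      0 ≤ (u : L2 T) ∧ 0 ≤ c • (one T : L2 T) - (u : L2 T) := by
  have h0 := rep_sub (c • one T) u
  have h1 := rep_smul c (one T)
  have h2 := rep_one T
  have h3 := rep_eq_zero_of_neg u
  have key : u ∈ L2starIn T (Icc 0 c) ↔
      ∀ᵐ t ∂(volume.restrict (Iio T)), 0 ≤ rep u t ∧ 0 ≤ rep (c • one T - u) t := by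
    rw [L2starIn, mem_ofPred_eq, ae_restrict_Ioo_iff]
    constructor <;> intro h
    · filter_upwards [h, h0, h1, h2, h3] with t h h0 h1 h2 h3
      rw [h0, h1, h2]
      rcases le_or_gt 0 t with ht | ht
      · have := h ht
        rw [indicator_of_mem (show t ∈ Ici 0 from ht), Pi.one_apply]
        exact ⟨this.1, by linarith [this.2]⟩
      · simp [h3 ht, ht]
    · filter_upwards [h, h0, h1, h2] with t h h0 h1 h2 ht
      rw [h0, h1, h2, indicator_of_mem (show t ∈ Ici 0 from ht), Pi.one_apply] at h
      exact ⟨h.1, by linarith [h.2]⟩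
  rw [key, eventually_and, ← Lp.coeFn_nonneg, ← Lp.coeFn_nonneg]
  exact Iff.rfl

/-- Weak limits are taken in `L²(-∞, T)`. They vanish on the negative axis because they are squeezed
between `0` and a multiple of `one T`, which vanishes there. -/
theorem mem_L2star_of_le {c : ℝ} {w : L2 T} (h0 : 0 ≤ w) (h1 : 0 ≤ c • (one T : L2 T) - w) :
    w ∈ L2star T := by
  show ∀ᵐ t ∂_, _
  filter_upwards [(Lp.coeFn_nonneg w).2 h0, (Lp.coeFn_nonneg _).2 h1,
    Lp.coeFn_sub (c • (one T : L2 T)) w, rep_smul c (one T), rep_one T] with t h2 h3 h4 h5 h6 ht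
  have h7 : (c • (one T : L2 T)) t = 0 := h5.trans (by rw [h6]; simp [ht])
  rw [h4, Pi.sub_apply, h7] at h3
  simp only [Pi.zero_apply] at h2 h3
  linarith

theorem norm_le_of_mem_L2starIn {c : ℝ} {u : L2star T} (hu : u ∈ L2starIn T (Icc 0 c)) :
    ‖(u : L2 T)‖ ≤ ‖c • (one T : L2 T)‖ := by
  obtain ⟨h0, h1⟩ := mem_L2starIn_Icc_iff.1 hu
  refine Lp.norm_le_norm_of_ae_le ?_
  filter_upwards [(Lp.coeFn_nonneg _).2 h0, (Lp.coeFn_nonneg _).2 h1,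
    Lp.coeFn_sub (c • (one T : L2 T)) (u : L2 T)] with t h2 h3 h4
  rw [h4, Pi.sub_apply] at h3
  simp only [Pi.zero_apply] at h2 h3
  rw [Real.norm_of_nonneg h2, Real.norm_of_nonneg (by linarith)]
  linarith

theorem exists_pairing_eq_inner (φ : 𝓓(domain T, ℝ)) :
    ∃ g : L2 T, ∀ v : L2star T, pairing φ v = inner ℝ (v : L2 T) g :=
  ⟨((continuous_deriv_test φ).memLp_of_hasCompactSupport φ.hasCompactSupport.deriv).toLp _,
    fun v => real_inner_comm (v : L2 T) _⟩

/-- For a convergent sequence of first coordinates the controls `z` are bounded in norm and have a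
weak limit along an ultrafilter. The constraints are linear inequalities between inner products with
fixed functions, so the limit pair satisfies them. -/
theorem isClosed_projection (T : ℝ) (σ : ℕ) :
    IsClosed ((fun x : Fin (1 + 1) → L2star T => x 0) '' switchesExt T σ) := by
  refine IsSeqClosed.isClosed fun u u₀ hu hlim => ?_
  choose x hx hxu using hu
  obtain ⟨z, hz⟩ := exists_weak_limit fun n => norm_le_of_mem_L2starIn (hx n).2.1
  have hulim : ∀ g : L2 T, Tendsto (fun n => inner ℝ (x n 0 : L2 T) g)
      (hyperfilter ℕ : Filter ℕ) (𝓝 (inner ℝ (u₀ : L2 T) g)) := by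
    intro g
    have h1 : Tendsto (fun n => (u n : L2 T)) (hyperfilter ℕ : Filter ℕ) (𝓝 (u₀ : L2 T)) :=
      ((continuous_subtype_val.tendsto u₀).comp hlim).mono_left Nat.hyperfilter_le_atTop
    refine (h1.inner tendsto_const_nhds).congr fun n => ?_
    rw [← hxu n]
  have hconst : ∀ v g : L2 T, Tendsto (fun _ : ℕ => inner ℝ v g) (hyperfilter ℕ : Filter ℕ)
      (𝓝 (inner ℝ v g)) := fun _ _ => tendsto_const_nhds
  have hz0 : 0 ≤ z := nonneg_of_tendsto_inner
    (fun n => (mem_L2starIn_Icc_iff.1 (hx n).2.1).1) hz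
  have hz1 : 0 ≤ ((σ : ℝ) / 2) • (one T : L2 T) - z := nonneg_of_tendsto_inner
    (fun n => (mem_L2starIn_Icc_iff.1 (hx n).2.1).2) fun g => by
      simp only [inner_sub_left]
      exact (hconst _ g).sub (hz g)
  refine ⟨![u₀, ⟨z, mem_L2star_of_le hz0 hz1⟩], ⟨?_, ?_, ?_, ?_⟩, rfl⟩
  · refine mem_L2starIn_Icc_iff.2 ⟨?_, ?_⟩
    · exact nonneg_of_tendsto_inner (fun n => (mem_L2starIn_Icc_iff.1 (hx n).1).1) hulim
    · exact nonneg_of_tendsto_inner (fun n => (mem_L2starIn_Icc_iff.1 (hx n).1).2) fun g => by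
        simp only [inner_sub_left]
        exact (hconst _ g).sub (hulim g)
  · exact mem_L2starIn_Icc_iff.2 ⟨hz0, hz1⟩
  · refine derivLE_iff.2 fun φ hφ => ?_
    obtain ⟨g, hg⟩ := exists_pairing_eq_inner φ
    rw [hg, hg]
    refine le_of_tendsto_of_tendsto' (hz g) (hulim g) fun n => ?_
    rw [← hg, ← hg]
    exact derivLE_iff.1 (hx n).2.2.1 φ hφ
  · refine derivLE_iff.2 fun φ hφ => ?_
    obtain ⟨g, hg⟩ := exists_pairing_eq_inner φ
    rw [hg, map_zero]
    refine le_of_tendsto' (hz g) fun n => ?_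
    rw [← hg, ← map_zero (pairing φ)]
    exact derivLE_iff.1 (hx n).2.2.2 φ hφ

theorem convex_L2starIn {S : Set ℝ} (hS : Convex ℝ S) : Convex ℝ (L2starIn T S) := by
  intro u hu v hv a b ha hb hab
  refine ae_restrict_Ioo_iff.2 ?_
  filter_upwards [ae_restrict_Ioo_iff.1 hu, ae_restrict_Ioo_iff.1 hv, rep_add (a • u) (b • v),
    rep_smul a u, rep_smul b v] with t h1 h2 h3 h4 h5 ht
  rw [h3, h4, h5]
  exact hS (h1 ht) (h2 ht) ha hb hab

theorem convex_switchesExt (T : ℝ) (σ : ℕ) : Convex ℝ (switchesExt T σ) := by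
  intro x hx y hy a b ha hb hab
  refine ⟨convex_L2starIn (convex_Icc _ _) hx.1 hy.1 ha hb hab,
    convex_L2starIn (convex_Icc _ _) hx.2.1 hy.2.1 ha hb hab, ?_, ?_⟩
  · refine derivLE_iff.2 fun φ hφ => ?_
    have h1 := derivLE_iff.1 hx.2.2.1 φ hφ
    have h2 := derivLE_iff.1 hy.2.2.1 φ hφ
    simp only [Pi.add_apply, Pi.smul_apply, map_add, map_smul, smul_eq_mul]
    gcongr
  · refine derivLE_iff.2 fun φ hφ => ?_
    have h1 := derivLE_iff.1 hx.2.2.2 φ hφ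
    have h2 := derivLE_iff.1 hy.2.2.2 φ hφ
    rw [map_zero] at h1 h2 ⊢
    simp only [Pi.add_apply, Pi.smul_apply, map_add, map_smul, smul_eq_mul]
    nlinarith

theorem projection_switchesExt (hT : 0 < T) (m : ℕ) :
    (fun x : Fin (1 + 1) → L2star T => x 0) '' switchesExt T (2 * m) =
      closure (convexHull ℝ (switches T (2 * m))) := by
  refine Subset.antisymm ?_ ?_
  · rintro _ ⟨x, hx, rfl⟩
    exact mem_closure_convexHull_switches hT hx
  · refine closure_minimal (convexHull_min ?_ ?_) (isClosed_projection T _)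
    · intro u hu
      obtain ⟨x, hx, h, -⟩ := exists_mem_switchesExt hT hu
      exact ⟨x, hx, h⟩
    · exact (convex_switchesExt T _).is_linear_image
        (LinearMap.proj (R := ℝ) (φ := fun _ : Fin (1 + 1) => L2star T) 0).isLinear

theorem convex_stepFunctions (hT : 0 < T) (N : ℕ) : Convex ℝ (stepFunctions T N) := by
  rintro u ⟨v, hv⟩ u' ⟨v', hv'⟩ a b - - -
  exact ⟨_, (hv.smul hT a).add hT (hv'.smul hT b)⟩

theorem projection_discretize (hT : 0 < T) (m : ℕ) {N : ℕ} (hN : 0 < N) :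
    (fun x : Fin (1 + 1) → L2star T => x 0) '' discretizeTuple (switchesExt T (2 * m)) N =
      convexHull ℝ (discretize (switches T (2 * m)) N) := by
  refine Subset.antisymm ?_ (convexHull_min ?_ ?_)
  · rintro _ ⟨x, hx, rfl⟩
    exact mem_convexHull_discretize hT hN hx
  · rintro u ⟨hu, hstep⟩
    obtain ⟨x, hx, h, hN⟩ := exists_mem_switchesExt hT hu
    exact ⟨x, ⟨hx, hN N hstep⟩, h⟩
  · have : Convex ℝ (discretizeTuple (switchesExt T (2 * m)) N) :=
      fun x hx y hy a b ha hb hab => ⟨convex_switchesExt T _ hx.1 hy.1 ha hb hab,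
        fun c => convex_stepFunctions hT N (hx.2 c) (hy.2 c) ha hb hab⟩
    exact this.is_linear_image
      (LinearMap.proj (R := ℝ) (φ := fun _ : Fin (1 + 1) => L2star T) 0).isLinear

/-! ### The list of constraints -/

/-- The affine-linear operator `(u, z) ↦ a u + b z + c`. -/
def affineOp (T a b c : ℝ) : (Fin (1 + 1) → L2star T) →ᴬ[ℝ] L2star T :=
  (a • ContinuousLinearMap.proj 0 + b • ContinuousLinearMap.proj 1 :
    (Fin (1 + 1) → L2star T) →L[ℝ] L2star T).toContinuousAffineMap +
    ContinuousAffineMap.const ℝ _ (c • one T)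

theorem affineOp_apply (a b c : ℝ) (x : Fin (1 + 1) → L2star T) :
    affineOp T a b c x = a • x 0 + b • x 1 + c • one T := rfl

theorem rep_affineOp (a b c : ℝ) (x : Fin (1 + 1) → L2star T) :
    ∀ᵐ t ∂(volume.restrict (Iio T)), 0 ≤ t →
      rep (affineOp T a b c x) t = a * rep (x 0) t + b * rep (x 1) t + c := by
  rw [affineOp_apply]
  filter_upwards [rep_add (a • x 0 + b • x 1) (c • one T), rep_add (a • x 0) (b • x 1),
    rep_smul a (x 0), rep_smul b (x 1), rep_smul c (one T), rep_one T]
    with t h1 h2 h3 h4 h5 h6 ht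
  rw [h1, h2, h3, h4, h5, h6, indicator_of_mem (show t ∈ Ici 0 from ht), Pi.one_apply, mul_one]

theorem isStep_affineOp {N : ℕ} (hT : 0 < T) (a b c : ℝ) {x : Fin (1 + 1) → L2star T}
    {v : Fin (1 + 1) → Fin N → ℝ} (hx : ∀ k, IsStep N (v k) (x k)) :
    IsStep N (fun i => a * v 0 i + b * v 1 i + c) (affineOp T a b c x) := by
  have := (((hx 0).smul hT a).add hT ((hx 1).smul hT b)).add hT ((isStep_one hT).smul hT c)
  rw [affineOp_apply]
  simpa using this

/-- The constraint `a u + b z + c ≥ 0` or `D(a u + b z + c) ≥ 0` with the coefficients of number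
`k`. -/
def constraint (T : ℝ) (σ : ℕ) (k : ℕ) : LinearConstraint T 1 where
  op := affineOp T (controlCoeff k) (counterCoeff k) (constCoeff σ k)
  kind := if k < 4 then .value else .derivative

theorem holds_constraint_value {σ k : ℕ} (hk : k < 4) (x : Fin (1 + 1) → L2star T) :
    (constraint T σ k).Holds x ↔ ∀ᵐ t ∂(volume.restrict (Iio T)), 0 ≤ t →
      0 ≤ controlCoeff k * rep (x 0) t + counterCoeff k * rep (x 1) t + constCoeff σ k := by
  have h := rep_affineOp (controlCoeff k) (counterCoeff k) (constCoeff σ k) x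
  simp only [LinearConstraint.Holds, constraint, hk, if_true]
  rw [ae_restrict_Ioo_iff]
  refine eventually_congr ?_
  filter_upwards [h] with t ht
  refine forall_congr' fun h0 => ?_
  rw [ht h0]

theorem holds_constraint_derivative {σ k : ℕ} (hk : ¬ k < 4) (x : Fin (1 + 1) → L2star T) :
    (constraint T σ k).Holds x ↔
      DerivLE 0 (affineOp T (controlCoeff k) (counterCoeff k) (constCoeff σ k) x) := by
  simp only [LinearConstraint.Holds, constraint, hk, if_false]

/-- The constraints that describe the extended formulation. -/
def constraints (T : ℝ) (σ : ℕ) : List (LinearConstraint T 1) :=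
  List.ofFn fun k : Fin 6 => constraint T σ k

theorem mem_switchesExt_iff (σ : ℕ) (x : Fin (1 + 1) → L2star T) :
    x ∈ switchesExt T σ ↔ ∀ C ∈ constraints T σ, C.Holds x := by
  have e0 : (constraint T σ 0).Holds x ↔
      ∀ᵐ t ∂(volume.restrict (Iio T)), 0 ≤ t → 0 ≤ rep (x 0) t := by
    rw [holds_constraint_value (by norm_num)]
    simp [controlCoeff, counterCoeff, constCoeff]
  have e1 : (constraint T σ 1).Holds x ↔
      ∀ᵐ t ∂(volume.restrict (Iio T)), 0 ≤ t → rep (x 0) t ≤ 1 := by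
    rw [holds_constraint_value (by norm_num)]
    simp [controlCoeff, counterCoeff, constCoeff]
  have e2 : (constraint T σ 2).Holds x ↔
      ∀ᵐ t ∂(volume.restrict (Iio T)), 0 ≤ t → 0 ≤ rep (x 1) t := by
    rw [holds_constraint_value (by norm_num)]
    simp [controlCoeff, counterCoeff, constCoeff]
  have e3 : (constraint T σ 3).Holds x ↔
      ∀ᵐ t ∂(volume.restrict (Iio T)), 0 ≤ t → rep (x 1) t ≤ (σ : ℝ) / 2 := by
    rw [holds_constraint_value (by norm_num)]
    simp [controlCoeff, counterCoeff, constCoeff, le_div_iff₀', add_comm, ← sub_eq_add_neg]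
  have e4 : (constraint T σ 4).Holds x ↔ DerivLE (x 0) (x 1) := by
    rw [holds_constraint_derivative (by norm_num), affineOp_apply,
      ← derivLE_zero_sub (u := x 0), sub_eq_neg_add]
    simp [controlCoeff, counterCoeff, constCoeff]
  have e5 : (constraint T σ 5).Holds x ↔ DerivLE 0 (x 1) := by
    rw [holds_constraint_derivative (by norm_num), affineOp_apply]
    simp [controlCoeff, counterCoeff, constCoeff]
  have hIcc : ∀ (u : L2star T) (c : ℝ), u ∈ L2starIn T (Icc 0 c) ↔
      (∀ᵐ t ∂(volume.restrict (Iio T)), 0 ≤ t → 0 ≤ rep u t) ∧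
        ∀ᵐ t ∂(volume.restrict (Iio T)), 0 ≤ t → rep u t ≤ c := by
    intro u c
    rw [L2starIn, mem_ofPred_eq, ae_restrict_Ioo_iff, ← eventually_and]
    simp only [mem_Icc, imp_and]
  have hS : x ∈ switchesExt T σ ↔ x 0 ∈ L2starIn T (Icc 0 1) ∧
      x 1 ∈ L2starIn T (Icc 0 ((σ : ℝ) / 2)) ∧ DerivLE (x 0) (x 1) ∧ DerivLE 0 (x 1) := Iff.rfl
  have hall : (∀ C ∈ constraints T σ, C.Holds x) ↔ ∀ k < 6, (constraint T σ k).Holds x := by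
    rw [constraints, List.forall_mem_ofFn_iff]
    exact ⟨fun h k hk => h ⟨k, hk⟩, fun h k => h k k.2⟩
  rw [hS, hIcc, hIcc, hall, ← e0, ← e1, ← e2, ← e3, ← e4, ← e5]
  constructor
  · rintro ⟨⟨h0, h1⟩, ⟨h2, h3⟩, h4, h5⟩ k hk
    interval_cases k <;> assumption
  · intro h
    exact ⟨⟨h 0 (by norm_num), h 1 (by norm_num)⟩, ⟨h 2 (by norm_num), h 3 (by norm_num)⟩,
      h 4 (by norm_num), h 5 (by norm_num)⟩

theorem isExtendedFormulation_switchesExt (hT : 0 < T) {σ : ℕ} (hσ : Even σ) :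
    IsExtendedFormulation (switches T σ) (switchesExt T σ) (constraints T σ) where
  subset_BV := fun _ hu => ⟨ae_restrict_Ioo_iff.2 (.of_forall fun _ _ => mem_univ _), hu.1.2⟩
  projection := by
    obtain ⟨m, rfl⟩ := hσ.two_dvd
    exact projection_switchesExt hT m
  linear := Set.ext fun x => mem_switchesExt_iff σ x

theorem entryCoeff_read {k c : ℕ} (hk : k < 6) (hc : c < 2) :
    entryCoeff (Register.read k, Register.read c) =
      if c = 0 then controlCoeff k else counterCoeff k := by
  rw [entryCoeff, Register.toNat_read hk, Register.toNat_read (hc.trans (by norm_num))]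

theorem compatible_switchesExt :
    CompatibleWithDiscretization encodingEvenInstance (fun p => (p.T : ℝ)) (fun _ => 1)
      (fun p => switches (p.T : ℝ) p.σ) (fun p => switchesExt (p.T : ℝ) p.σ)
      (fun p => constraints (p.T : ℝ) p.σ) where
  projection := by
    intro p N hN
    obtain ⟨m, hm⟩ := p.even_σ.two_dvd
    simp only [hm]
    exact projection_discretize (Rat.cast_pos.2 p.T_pos) m hN
  mapsTo := by
    intro p N hN C hC x hx
    obtain ⟨k, rfl⟩ := List.mem_ofFn.1 hC
    choose v hv using hx
    exact ⟨_, isStep_affineOp (Rat.cast_pos.2 p.T_pos) _ _ _ hv⟩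
  coefficients := by
    refine ⟨_, _, polyTime_matrix encodingEvenInstance, polyTime_const, ?_⟩
    intro p N hN k v x hx
    have hk : (k : ℕ) < 6 := by simpa [constraints] using k.2
    have hop : ((constraints (p.T : ℝ) p.σ).get k).op =
        affineOp p.T (controlCoeff k) (counterCoeff k) (constCoeff p.σ k) := by
      have : (constraints (p.T : ℝ) p.σ).get k = constraint p.T p.σ k := by
        rw [List.get_eq_getElem]
        exact List.getElem_ofFn (f := fun k : Fin 6 => constraint p.T p.σ k) k.2
      rw [this, constraint]
    have h := isStep_affineOp (Rat.cast_pos.2 p.T_pos) (controlCoeff k) (counterCoeff k)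
      (constCoeff p.σ k) hx
    rw [hop]
    convert h using 2 with i
    simp only [Register.toNat_read hk]
    have h0 := entryCoeff_read hk (c := 0) (by norm_num)
    have h1 := entryCoeff_read hk (c := 1) (by norm_num)
    simp [h0, h1, Fin.val_inj, apply_ite, ite_mul]

end

end Switching

theorem mainTheorem3 :
    ∃ S : ∀ p : Switching.EvenInstance, List (Switching.LinearConstraint (p.T : ℝ) 1),
      (∀ p : Switching.EvenInstance,
        Switching.IsExtendedFormulation (Switching.switches (p.T : ℝ) p.σ)
          (Switching.switchesExt (p.T : ℝ) p.σ) (S p)) ∧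
      Switching.IsSmall Switching.encodingEvenInstance
        (fun p => (p.T : ℝ)) (fun _ => 1) S ∧
      Switching.CompatibleWithDiscretization Switching.encodingEvenInstance
        (fun p => (p.T : ℝ)) (fun _ => 1)
        (fun p => Switching.switches (p.T : ℝ) p.σ)
        (fun p => Switching.switchesExt (p.T : ℝ) p.σ) S := by
  -- The constant polynomial `6` bounds both the two controls and the six constraints.
  refine ⟨fun p => Switching.constraints (p.T : ℝ) p.σ, fun p => ?_, ⟨6, fun p => ?_⟩,
    Switching.compatible_switchesExt⟩
  · exact Switching.isExtendedFormulation_switchesExt (Rat.cast_pos.2 p.T_pos) p.even_σ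
  · simp [Switching.constraints]
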